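/- Let $k$ be a field and $Q$ an arbitrary quiver (not necessarily finite) without oriented cycles. Let $C=kQ^c$ be its path coalgebra: the $k$-vector space with basis all paths of $Q$ (including the trivial ones), with $\Delta(p)=\sum_{p=qr}q\otimes r$, the sum being over all ways of writing $p$ as a path $q$ followed by a path $r$, and with $\varepsilon(p)=1$ if $p$ is trivial and $\varepsilon(p)=0$ otherwise. For a coalgebra $E$ and a subspace $S\subseteq E$ let $\mathrm{Gal}(E/S)$ be the group of coalgebra automorphisms $\sigma$ of $E$ with $\sigma(d)=d$ for all $d\in S$, and for a subgroup $H\le\mathrm{Aut}(E)$ let $\mathrm{Inv}(H)=\{c\in E\mid \sigma(c)=c\ \text{for all}\ \sigma\in H\}$. For subcoalgebras $D\subseteq E\subseteq C$ with $D$ large, i.e. containing all paths of length at most $1$, call $E/D$ a Galois extension if $\sigma(E)=E$ for every $\sigma\in\mathrm{Gal}(C/D)$. Let $\mathcal C(D,E)$ be the set of subcoalgebras $M$ with $D\subseteq M\subseteq E$, and let $\mathcal G(D,E)=\{\mathrm{Gal}(E/M)\mid M\in\mathcal C(D,E)\}$ be the set of admissible subgroups of $\mathrm{Aut}(E)$.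 Theorem. Let $D\subseteq C$ be a large subcoalgebra and $E/D$ a Galois extension. Then: (1) The map $\mathrm{Inv}\colon\mathcal G(D,E)\to\mathcal C(D,E)$ is well defined and is the inverse of the map $\mathrm{Gal}(E/ -)\colon\mathcal C(D,E)\to\mathcal G(D,E)$. (2) Let $M,N\in\mathcal C(D,E)$, $H=\mathrm{Gal}(E/M)$ and $G=\mathrm{Gal}(E/N)$. Then $\mathrm{Inv}(\langle H, G\rangle)=M\cap N$ and $\mathrm{Inv}(H\cap G)=M+N$, where $\langle H, G\rangle$ is the subgroup of $\mathrm{Aut}(E)$ generated by $H$ and $G$. (3) Let $H\in\mathcal G(D,E)$. Then $H\lhd\mathrm{Gal}(E/D)$ if and only if $\mathrm{Inv}(H)$ is a Galois extension of $D$, and in this case $\mathrm{Gal}(E/D)/H\cong\mathrm{Gal}(\mathrm{Inv}(H)/D)$. -/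

import Mathlib

open scoped TensorProduct

universe u v w

noncomputable section

namespace PathGalois

/-! ### The automorphism group of a coalgebra, Galois groups and fixed points -/

section Galois

variable {k : Type w} [CommSemiring k] {E : Type u} [AddCommMonoid E] [Module k E] [Coalgebra k E]

/-- The group of coalgebra automorphisms of `E`, with composition `(σ * τ) x = σ (τ x)`. -/
instance autGroup : Group (E ≃ₗc[k] E) where
  mul σ τ := τ.trans σ
  one := CoalgEquiv.refl k E
  inv σ := σ.symm
  mul_assoc _ _ _ := rfl
  one_mul _ := rfl
  mul_one _ := rfl
  inv_mul_cancel σ := CoalgEquiv.ext fun x => σ.symm_apply_apply x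

/-- The Galois group `Gal(E/S)` of a coalgebra `E` over a subspace `S`: the coalgebra automorphisms
of `E` that fix every element of `S`. -/
def galoisGroup (S : Submodule k E) : Subgroup (E ≃ₗc[k] E) where
  carrier := {σ | ∀ d ∈ S, σ d = d}
  mul_mem' {σ τ} hσ hτ d hd := by
    change σ (τ d) = d
    rw [hτ d hd, hσ d hd]
  one_mem' _ _ := rfl
  inv_mem' {σ} hσ d hd := by
    change σ.symm d = d
    conv_lhs => rw [← hσ d hd]
    exact σ.symm_apply_apply d

/-- The subspace `Inv(H)` of fixed points of a group `H` of coalgebra automorphisms of `E`. -/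
def fixedPoints (H : Subgroup (E ≃ₗc[k] E)) : Submodule k E where
  carrier := {c | ∀ σ ∈ H, σ c = c}
  add_mem' {x y} hx hy σ hσ := by
    rw [map_add, hx σ hσ, hy σ hσ]
  zero_mem' σ _ := map_zero σ
  smul_mem' a x hx σ hσ := by
    rw [map_smul, hx σ hσ]

end Galois

/-! ### Subcoalgebras -/

/-- A subcoalgebra of a coalgebra `C` over a field: a subspace `D` with `Δ(D) ⊆ D ⊗ D`. -/
structure Subcoalgebra (k : Type w) [Field k] (C : Type u) [AddCommGroup C] [Module k C]
    [Coalgebra k C] where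
  toSubmodule : Submodule k C
  comul_mem : ∀ x ∈ toSubmodule, Coalgebra.comul (R := k) x ∈
    LinearMap.range (TensorProduct.map toSubmodule.subtype toSubmodule.subtype)

namespace Subcoalgebra

variable {k : Type w} [Field k] {C : Type u} [AddCommGroup C] [Module k C] [Coalgebra k C]

/-- The underlying vector space of a subcoalgebra. -/
abbrev Carrier (D : Subcoalgebra k C) : Type u := D.toSubmodule

instance : CoeSort (Subcoalgebra k C) (Type u) := ⟨Carrier⟩

theorem map_subtype_injective (D : Subcoalgebra k C) :
    Function.Injective (TensorProduct.map D.toSubmodule.subtype D.toSubmodule.subtype) :=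
  TensorProduct.map_injective_of_flat_flat _ _ D.toSubmodule.injective_subtype
    D.toSubmodule.injective_subtype

/-- The comultiplication of a subcoalgebra `D`: the unique map whose composition with the inclusion
`D ⊗ D → C ⊗ C` is the restriction to `D` of the comultiplication of `C`. -/
def comulAux (D : Subcoalgebra k C) : D →ₗ[k] D ⊗[k] D :=
  (LinearEquiv.ofInjective _ D.map_subtype_injective).symm.toLinearMap ∘ₗ
    (Coalgebra.comul ∘ₗ D.toSubmodule.subtype).codRestrict
      (LinearMap.range (TensorProduct.map D.toSubmodule.subtype D.toSubmodule.subtype))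
      (fun x => D.comul_mem x x.2)

theorem map_comulAux (D : Subcoalgebra k C) :
    TensorProduct.map D.toSubmodule.subtype D.toSubmodule.subtype ∘ₗ D.comulAux =
      Coalgebra.comul ∘ₗ D.toSubmodule.subtype := by
  ext x
  have h := LinearEquiv.ofInjective_apply (h := D.map_subtype_injective) _ (D.comulAux x)
  rw [LinearMap.comp_apply, ← h, comulAux, LinearMap.comp_apply]
  exact congrArg Subtype.val (LinearEquiv.apply_symm_apply _ _)

instance (D : Subcoalgebra k C) : CoalgebraStruct k D where
  comul := D.comulAux
  counit := Coalgebra.counit ∘ₗ D.toSubmodule.subtype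

/-- A subcoalgebra is a coalgebra. -/
instance (D : Subcoalgebra k C) : Coalgebra k D where
  coassoc := by
    have hinj : Function.Injective (TensorProduct.map D.toSubmodule.subtype
        (TensorProduct.map D.toSubmodule.subtype D.toSubmodule.subtype)) :=
      TensorProduct.map_injective_of_flat_flat _ _ D.toSubmodule.injective_subtype
        D.map_subtype_injective
    have hassoc : ∀ (z : D ⊗[k] D) (y : D), TensorProduct.map D.toSubmodule.subtype
        (TensorProduct.map D.toSubmodule.subtype D.toSubmodule.subtype)
          (TensorProduct.assoc k D D D (z ⊗ₜ[k] y)) =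
        TensorProduct.assoc k C C C
          (TensorProduct.map D.toSubmodule.subtype D.toSubmodule.subtype z ⊗ₜ[k]
            D.toSubmodule.subtype y) := fun z y => by
      induction z with
      | zero => simp
      | add a b ha hb => simp only [map_add, TensorProduct.add_tmul, ha, hb]
      | tmul a b => simp
    have hl : ∀ t : D ⊗[k] D, TensorProduct.map D.toSubmodule.subtype
        (TensorProduct.map D.toSubmodule.subtype D.toSubmodule.subtype)
          (TensorProduct.assoc k D D D (D.comulAux.rTensor D t)) =
        TensorProduct.assoc k C C C ((Coalgebra.comul (R := k) (A := C)).rTensor C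
          (TensorProduct.map D.toSubmodule.subtype D.toSubmodule.subtype t)) := fun t => by
      induction t with
      | zero => simp
      | add a b ha hb => simp only [map_add, ha, hb]
      | tmul x y =>
        have hx := LinearMap.congr_fun D.map_comulAux x
        simp only [LinearMap.comp_apply] at hx
        simp only [LinearMap.rTensor_tmul, TensorProduct.map_tmul, ← hx]
        exact hassoc (D.comulAux x) y
    have hr : ∀ t : D ⊗[k] D, TensorProduct.map D.toSubmodule.subtype
        (TensorProduct.map D.toSubmodule.subtype D.toSubmodule.subtype)
          (D.comulAux.lTensor D t) =
        (Coalgebra.comul (R := k) (A := C)).lTensor C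
          (TensorProduct.map D.toSubmodule.subtype D.toSubmodule.subtype t) := fun t => by
      induction t with
      | zero => simp
      | add a b ha hb => simp only [map_add, ha, hb]
      | tmul x y =>
        have hy := LinearMap.congr_fun D.map_comulAux y
        simp only [LinearMap.comp_apply] at hy
        simp only [LinearMap.lTensor_tmul, TensorProduct.map_tmul, hy]
    refine LinearMap.ext fun x => hinj ?_
    have hx := LinearMap.congr_fun D.map_comulAux x
    simp only [LinearMap.comp_apply] at hx
    refine (hl (D.comulAux x)).trans ((hr (D.comulAux x)).trans ?_).symm
    rw [hx]
    exact (Coalgebra.coassoc_apply _).symm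
  rTensor_counit_comp_comul := by
    have hl : ∀ t : D ⊗[k] D, D.toSubmodule.subtype.lTensor k
          ((Coalgebra.counit ∘ₗ D.toSubmodule.subtype).rTensor D t) =
        (Coalgebra.counit (R := k) (A := C)).rTensor C
          (TensorProduct.map D.toSubmodule.subtype D.toSubmodule.subtype t) := fun t => by
      induction t with
      | zero => simp
      | add a b ha hb => simp only [map_add, ha, hb]
      | tmul x y => simp
    refine LinearMap.ext fun x => Module.Flat.lTensor_preserves_injective_linearMap
      (M := k) D.toSubmodule.subtype D.toSubmodule.injective_subtype ?_
    have hx := LinearMap.congr_fun D.map_comulAux x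
    simp only [LinearMap.comp_apply] at hx
    refine (hl (D.comulAux x)).trans ?_
    rw [hx, Coalgebra.rTensor_counit_comul]
    simp
  lTensor_counit_comp_comul := by
    have hl : ∀ t : D ⊗[k] D, D.toSubmodule.subtype.rTensor k
          ((Coalgebra.counit ∘ₗ D.toSubmodule.subtype).lTensor D t) =
        (Coalgebra.counit (R := k) (A := C)).lTensor C
          (TensorProduct.map D.toSubmodule.subtype D.toSubmodule.subtype t) := fun t => by
      induction t with
      | zero => simp
      | add a b ha hb => simp only [map_add, ha, hb]
      | tmul x y => simp
    refine LinearMap.ext fun x => Module.Flat.rTensor_preserves_injective_linearMap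
      (M := k) D.toSubmodule.subtype D.toSubmodule.injective_subtype ?_
    have hx := LinearMap.congr_fun D.map_comulAux x
    simp only [LinearMap.comp_apply] at hx
    refine (hl (D.comulAux x)).trans ?_
    rw [hx, Coalgebra.lTensor_counit_comul]
    simp

end Subcoalgebra

/-! ### The path coalgebra of a quiver -/

section PathCoalgebra

variable (k : Type w) [Field k] (Q : Type u) [Quiver.{v} Q]

/-- All paths of the quiver, with their endpoints. -/
abbrev AllPaths : Type (max u v) := Σ a b : Q, Quiver.Path a b

/-- The vector space with basis the paths of the quiver, which carries the path coalgebra. -/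
def PathCoalgebra : Type (max u v w) := AllPaths Q →₀ k

instance : AddCommGroup (PathCoalgebra k Q) := inferInstanceAs (AddCommGroup (AllPaths Q →₀ k))

instance : Module k (PathCoalgebra k Q) := inferInstanceAs (Module k (AllPaths Q →₀ k))

variable {Q}

/-- The basis element of the path coalgebra given by a path. -/
def ofPath {a b : Q} (p : Quiver.Path a b) : PathCoalgebra k Q :=
  Finsupp.single (⟨a, b, p⟩ : AllPaths Q) (1 : k)

/-- The linear map out of the path coalgebra with prescribed values on the paths. -/
def liftPath {M : Type*} [AddCommGroup M] [Module k M]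
    (f : ∀ {a b : Q}, Quiver.Path a b → M) : PathCoalgebra k Q →ₗ[k] M :=
  Finsupp.linearCombination k (fun p : AllPaths Q => f p.2.2)

/-- The ways to write a path `p` as a composition of two paths, which may be trivial. Each of the
`length p + 1` ways occurs exactly once. -/
def splits {a : Q} : ∀ {b : Q}, Quiver.Path a b → List (Σ c : Q, Quiver.Path a c × Quiver.Path c b)
  | _, .nil => [⟨a, .nil, .nil⟩]
  | b, .cons p α => (splits p).map (fun s => ⟨s.1, s.2.1, s.2.2.cons α⟩) ++ [⟨b, p.cons α, .nil⟩]

/-- `Δ(p) = ∑ q ⊗ r`, over all ways to write the path `p` as `q` followed by `r`;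
`ε(p) = 1` if `p` is trivial and `ε(p) = 0` otherwise. -/
instance : CoalgebraStruct k (PathCoalgebra k Q) where
  comul := liftPath k fun p =>
    ((splits p).map fun s => ofPath k s.2.1 ⊗ₜ[k] ofPath k s.2.2).sum
  counit := liftPath k fun p => if p.length = 0 then 1 else 0

variable {k}

@[simp] theorem liftPath_ofPath {M : Type*} [AddCommGroup M] [Module k M]
    (f : ∀ {a b : Q}, Quiver.Path a b → M) {a b : Q} (p : Quiver.Path a b) :
    liftPath k f (ofPath k p) = f p :=
  (Finsupp.linearCombination_single k (1 : k) (⟨a, b, p⟩ : AllPaths Q)).trans (one_smul k _)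

theorem hom_ext_path {M : Type*} [AddCommGroup M] [Module k M]
    {f g : PathCoalgebra k Q →ₗ[k] M}
    (h : ∀ (a b : Q) (p : Quiver.Path a b), f (ofPath k p) = g (ofPath k p)) : f = g := by
  refine Finsupp.lhom_ext' fun p => LinearMap.ext_ring ?_
  exact h p.1 p.2.1 p.2.2

theorem comul_ofPath {a b : Q} (p : Quiver.Path a b) :
    Coalgebra.comul (R := k) (ofPath k p) =
      ((splits p).map fun s => ofPath k s.2.1 ⊗ₜ[k] ofPath k s.2.2).sum :=
  liftPath_ofPath _ p

theorem counit_ofPath {a b : Q} (p : Quiver.Path a b) :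
    Coalgebra.counit (R := k) (ofPath k p) = if p.length = 0 then 1 else 0 :=
  liftPath_ofPath _ p

theorem list_sum_tmul {M N ι : Type*} [AddCommGroup M] [Module k M] [AddCommGroup N] [Module k N]
    (l : List ι) (f : ι → M) (y : N) :
    (l.map f).sum ⊗ₜ[k] y = (l.map fun i => f i ⊗ₜ[k] y).sum := by
  induction l with
  | nil => simp
  | cons i l ih => simp [TensorProduct.add_tmul, ih]

theorem tmul_list_sum {M N ι : Type*} [AddCommGroup M] [Module k M] [AddCommGroup N] [Module k N]
    (l : List ι) (f : ι → N) (x : M) :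
    x ⊗ₜ[k] (l.map f).sum = (l.map fun i => x ⊗ₜ[k] f i).sum := by
  induction l with
  | nil => simp
  | cons i l ih => simp [TensorProduct.tmul_add, ih]

theorem sum_splits_splits {N : Type*} [AddCommMonoid N] {a b : Q} (p : Quiver.Path a b)
    (f : ∀ {c d : Q}, Quiver.Path a c → Quiver.Path c d → Quiver.Path d b → N) :
    ((splits p).map fun s => ((splits s.2.1).map fun t => f t.2.1 t.2.2 s.2.2).sum).sum =
      ((splits p).map fun s => ((splits s.2.2).map fun t => f s.2.1 t.2.1 t.2.2).sum).sum := by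
  induction p with
  | nil => simp [splits]
  | cons p α ih =>
    have := ih (fun x y z => f x y (z.cons α))
    simp [splits, List.sum_map_add, Function.comp_def, this, add_assoc]

theorem sum_splits_left {N : Type*} [AddCommMonoid N] [Module k N] {a b : Q}
    (p : Quiver.Path a b) (f : ∀ {c : Q}, Quiver.Path c b → N) :
    ((splits p).map fun s => (if s.2.1.length = 0 then (1 : k) else 0) • f s.2.2).sum = f p := by
  induction p with
  | nil => simp [splits]
  | cons p α ih =>
    have := ih (fun x => f (x.cons α))
    simpa [splits, Function.comp_def] using this

theorem sum_splits_right {N : Type*} [AddCommMonoid N] [Module k N] {a b : Q}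
    (p : Quiver.Path a b) (f : ∀ {c : Q}, Quiver.Path a c → N) :
    ((splits p).map fun s => (if s.2.2.length = 0 then (1 : k) else 0) • f s.2.1).sum = f p := by
  cases p with
  | nil => simp [splits]
  | cons p α => simp [splits, Function.comp_def]

/-- The path coalgebra `kQᶜ`. -/
instance : Coalgebra k (PathCoalgebra k Q) where
  coassoc := by
    refine hom_ext_path fun a b p => ?_
    have h := sum_splits_splits p
      (fun x y z => ofPath k x ⊗ₜ[k] (ofPath k y ⊗ₜ[k] ofPath k z))
    simpa [comul_ofPath, map_list_sum, Function.comp_def, list_sum_tmul, tmul_list_sum] using h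
  rTensor_counit_comp_comul := by
    refine hom_ext_path fun a b p => ?_
    have h := sum_splits_left (k := k) p (fun x => (1 : k) ⊗ₜ[k] ofPath k x)
    simpa [comul_ofPath, counit_ofPath, map_list_sum, Function.comp_def,
      TensorProduct.ite_tmul, TensorProduct.tmul_ite] using h
  lTensor_counit_comp_comul := by
    refine hom_ext_path fun a b p => ?_
    have h := sum_splits_right (k := k) p (fun x => ofPath k x ⊗ₜ[k] (1 : k))
    simpa [comul_ofPath, counit_ofPath, map_list_sum, Function.comp_def,
      TensorProduct.ite_tmul, TensorProduct.tmul_ite] using h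

end PathCoalgebra

/-! ### Large subcoalgebras and Galois extensions -/

/-- A quiver is acyclic if it has no oriented cycle, i.e. every path from a vertex to itself is
trivial. -/
def IsAcyclic (Q : Type u) [Quiver.{v} Q] : Prop :=
  ∀ (a : Q) (p : Quiver.Path a a), p.length = 0

variable {k : Type w} [Field k] {Q : Type u} [Quiver.{v} Q]

/-- A subcoalgebra of the path coalgebra is large if it contains all paths of length at most one. -/
def IsLarge (D : Subcoalgebra k (PathCoalgebra k Q)) : Prop :=
  ∀ (a b : Q) (p : Quiver.Path a b), p.length ≤ 1 → ofPath k p ∈ D.toSubmodule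

/-- For subcoalgebras `D`, `E` of the path coalgebra `C = kQᶜ`, `E/D` is a Galois extension if
`D ⊆ E` and `σ(E) = E` for every `σ ∈ Gal(C/D)`. -/
def IsGaloisExtension (D E : Subcoalgebra k (PathCoalgebra k Q)) : Prop :=
  D.toSubmodule ≤ E.toSubmodule ∧
    ∀ σ ∈ galoisGroup D.toSubmodule,
      E.toSubmodule.map ((σ : PathCoalgebra k Q ≃ₗ[k] PathCoalgebra k Q) :
        PathCoalgebra k Q →ₗ[k] PathCoalgebra k Q) = E.toSubmodule

/-- `Gal(E/M)`, for a subcoalgebra `E` of `C` and a subspace `M` of `C` (in use, `M ⊆ E`): the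
coalgebra automorphisms of `E` that fix every element of `M`. -/
def relGal (E : Subcoalgebra k (PathCoalgebra k Q)) (M : Submodule k (PathCoalgebra k Q)) :
    Subgroup (E ≃ₗc[k] E) :=
  galoisGroup (M.comap E.toSubmodule.subtype)

/-- `Inv(H)`, for a group `H` of automorphisms of a subcoalgebra `E` of `C`, as a subspace of `C`
(contained in `E`). -/
def relInv {E : Subcoalgebra k (PathCoalgebra k Q)} (H : Subgroup (E ≃ₗc[k] E)) :
    Submodule k (PathCoalgebra k Q) :=
  (fixedPoints H).map E.toSubmodule.subtype

/-- `𝒞(D, E)`: the intermediate subcoalgebras `D ⊆ M ⊆ E`. -/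
def intermediateCoalgebras (D E : Subcoalgebra k (PathCoalgebra k Q)) :
    Set (Subcoalgebra k (PathCoalgebra k Q)) :=
  {M | D.toSubmodule ≤ M.toSubmodule ∧ M.toSubmodule ≤ E.toSubmodule}

/-- `𝒢(D, E)`: the admissible subgroups of `Aut(E)`, i.e. those of the form `Gal(E/M)` for an
intermediate subcoalgebra `M`. -/
def admissibleSubgroups (D E : Subcoalgebra k (PathCoalgebra k Q)) : Set (Subgroup (E ≃ₗc[k] E)) :=
  {H | ∃ M ∈ intermediateCoalgebras D E, H = relGal E M.toSubmodule}

end PathGalois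

end

/-!
The proof rests on two facts about the path coalgebra `C = kQᶜ`.

*There are enough automorphisms.* A functional `φ` on `C` with value `1` on the vertices is
invertible for the convolution product, with inverse `ψ`, because `x ↦ x₁ φ(x₂)` is the identity
plus an operator that shortens paths (`exists_convolution_inverse`). So
`x ↦ ψ(x₁) x₂ φ(x₃)` is an automorphism of `C` (`innerAut`). It maps every subcoalgebra onto itself,
and fixes a subcoalgebra `M` pointwise if `φ - ε` vanishes on `M`. If `x` is fixed by all the inner
automorphisms with `φ - ε` vanishing on a large subcoalgebra `M`, then `x₁ f(x₂) = f(x₁) x₂` for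
all functionals `f` vanishing on `M`. Pairing with the dual of a vertex `b` puts the difference
of the parts of `x` starting at `b` and ending at `b` into `M`, hence also every component of `x`
between two distinct vertices; since `Q` is acyclic the remaining components are combinations of
vertices, and `x ∈ M` (`mem_of_hits_eq`). This gives `Inv(Gal(E/M)) = M` (`relInv_relGal`), and with
it the correspondence and its behaviour on sums and intersections.

*Automorphisms extend.* Let `t : M → C` be a coalgebra map that is the identity on a large
subcoalgebra. If `t` respects the projection `π₀` to the span of the vertices, then it satisfies
`t(x) = π₀(x) + ∑ t(x₁) θ(x₂)`, where `θ = π₁ ∘ t` is its arrow part and the product is concatenation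
of paths. Extending `θ` to `C` and solving this recursion along the length of paths extends `t` to
an endomorphism of `C`, which is unitriangular for the length filtration
(`exists_extension_of_lengthProj_zero`). In general the idempotents `eₐ ∘ t` of the dual algebra
are conjugate to the idempotents `eₐ` of the vertices, so an inner automorphism reduces to the
previous case (`exists_extension`). The statements on normal subgroups then follow as in the Galois
theory of fields: for an intermediate Galois extension `M/D`, restriction is a surjective homomorphism
`Gal(E/D) → Gal(M/D)` with kernel `Gal(E/M)`.
-/

noncomputable section

namespace PathGalois

open Coalgebra

/-! ### Hit actions of functionals on a coalgebra -/

section HitActions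

variable {k : Type w} [Field k] {C : Type u} [AddCommGroup C] [Module k C] [Coalgebra k C]

/-- The right hit operator `x ↦ x₁ f(x₂)` of a functional `f`. -/
def rightHit (f : C →ₗ[k] k) : C →ₗ[k] C :=
  (TensorProduct.rid k C).toLinearMap ∘ₗ f.lTensor C ∘ₗ comul

/-- The left hit operator `x ↦ f(x₁) x₂` of a functional `f`. -/
def leftHit (f : C →ₗ[k] k) : C →ₗ[k] C :=
  (TensorProduct.lid k C).toLinearMap ∘ₗ f.rTensor C ∘ₗ comul

theorem comul_comp_rightHit (f : C →ₗ[k] k) :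
    comul ∘ₗ rightHit f = (rightHit f).lTensor C ∘ₗ comul := by
  have h₁ : comul ∘ₗ (TensorProduct.rid k C).toLinearMap ∘ₗ f.lTensor C =
      (TensorProduct.rid k (C ⊗[k] C)).toLinearMap ∘ₗ f.lTensor (C ⊗[k] C) ∘ₗ
        comul.rTensor C := by
    ext; simp
  have h₂ : (TensorProduct.rid k (C ⊗[k] C)).toLinearMap ∘ₗ f.lTensor (C ⊗[k] C) =
      ((TensorProduct.rid k C).toLinearMap ∘ₗ f.lTensor C).lTensor C ∘ₗ
        (TensorProduct.assoc k C C C).toLinearMap := by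
    ext; simp
  ext x
  have h₁' := LinearMap.congr_fun h₁ (comul x)
  have h₂' := LinearMap.congr_fun h₂ (comul.rTensor C (comul x))
  simp only [LinearMap.comp_apply, LinearEquiv.coe_coe, coassoc_apply] at h₁' h₂'
  simp only [rightHit, LinearMap.comp_apply, LinearEquiv.coe_coe, LinearMap.lTensor_comp] at h₂' ⊢
  rw [h₁', h₂']

theorem comul_comp_leftHit (f : C →ₗ[k] k) :
    comul ∘ₗ leftHit f = (leftHit f).rTensor C ∘ₗ comul := by
  have h₁ : comul ∘ₗ (TensorProduct.lid k C).toLinearMap ∘ₗ f.rTensor C =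
      (TensorProduct.lid k (C ⊗[k] C)).toLinearMap ∘ₗ f.rTensor (C ⊗[k] C) ∘ₗ
        comul.lTensor C := by
    ext; simp
  have h₂ : (TensorProduct.lid k (C ⊗[k] C)).toLinearMap ∘ₗ f.rTensor (C ⊗[k] C) ∘ₗ
        (TensorProduct.assoc k C C C).toLinearMap =
      ((TensorProduct.lid k C).toLinearMap ∘ₗ f.rTensor C).rTensor C := by
    ext; simp [TensorProduct.smul_tmul']
  ext x
  have h₁' := LinearMap.congr_fun h₁ (comul x)
  have h₂' := LinearMap.congr_fun h₂ (comul.rTensor C (comul x))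
  simp only [LinearMap.comp_apply, LinearEquiv.coe_coe, coassoc_apply] at h₁' h₂'
  simp only [leftHit, LinearMap.comp_apply, LinearEquiv.coe_coe, LinearMap.rTensor_comp] at h₂' ⊢
  rw [h₁', h₂']

theorem rTensor_rightHit_comp_comul (f : C →ₗ[k] k) :
    (rightHit f).rTensor C ∘ₗ comul = (leftHit f).lTensor C ∘ₗ comul := by
  have h : ((TensorProduct.rid k C).toLinearMap ∘ₗ f.lTensor C).rTensor C =
      ((TensorProduct.lid k C).toLinearMap ∘ₗ f.rTensor C).lTensor C ∘ₗ
        (TensorProduct.assoc k C C C).toLinearMap := by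
    ext; simp [TensorProduct.smul_tmul]
  ext x
  have h' := LinearMap.congr_fun h (comul.rTensor C (comul x))
  simp only [LinearMap.comp_apply, LinearEquiv.coe_coe, coassoc_apply] at h'
  simp only [leftHit, rightHit, LinearMap.comp_apply, LinearMap.rTensor_comp,
    LinearMap.lTensor_comp] at h' ⊢
  rw [h']

theorem rightHit_leftHit (f g : C →ₗ[k] k) (x : C) :
    rightHit f (leftHit g x) = leftHit g (rightHit f x) := by
  have h₁ := LinearMap.congr_fun (comul_comp_leftHit g) x
  have h₂ := LinearMap.congr_fun (comul_comp_rightHit f) x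
  have h : (TensorProduct.rid k C).toLinearMap ∘ₗ f.lTensor C ∘ₗ (leftHit g).rTensor C =
      leftHit g ∘ₗ (TensorProduct.rid k C).toLinearMap ∘ₗ f.lTensor C := by
    ext; simp
  have h' := LinearMap.congr_fun h (comul x)
  simp only [LinearMap.comp_apply, LinearEquiv.coe_coe] at h₁ h'
  rw [rightHit, LinearMap.comp_apply, LinearMap.comp_apply, h₁, LinearEquiv.coe_coe, h']
  rfl

theorem rightHit_counit : rightHit (counit : C →ₗ[k] k) = LinearMap.id := by
  ext x; simp [rightHit]

theorem leftHit_counit : leftHit (counit : C →ₗ[k] k) = LinearMap.id := by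
  ext x; simp [leftHit]

theorem rightHit_add (f g : C →ₗ[k] k) : rightHit (f + g) = rightHit f + rightHit g := by
  ext x; simp [rightHit, LinearMap.lTensor_add]

theorem leftHit_add (f g : C →ₗ[k] k) : leftHit (f + g) = leftHit f + leftHit g := by
  ext x; simp [leftHit, LinearMap.rTensor_add]

theorem counit_comp_rightHit (f : C →ₗ[k] k) : counit ∘ₗ rightHit f = f := by
  have h : counit ∘ₗ (TensorProduct.rid k C).toLinearMap ∘ₗ f.lTensor C =
      f ∘ₗ (TensorProduct.lid k C).toLinearMap ∘ₗ counit.rTensor C := by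
    ext; simp [mul_comm]
  ext x
  have h' := LinearMap.congr_fun h (comul x)
  simp only [LinearMap.comp_apply, LinearEquiv.coe_coe, rTensor_counit_comul] at h'
  simpa [rightHit] using h'

theorem counit_comp_leftHit (f : C →ₗ[k] k) : counit ∘ₗ leftHit f = f := by
  have h : counit ∘ₗ (TensorProduct.lid k C).toLinearMap ∘ₗ f.rTensor C =
      f ∘ₗ (TensorProduct.rid k C).toLinearMap ∘ₗ counit.lTensor C := by
    ext; simp [mul_comm]
  ext x
  have h' := LinearMap.congr_fun h (comul x)
  simp only [LinearMap.comp_apply, LinearEquiv.coe_coe, lTensor_counit_comul] at h'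
  simpa [leftHit] using h'

/-- Both sides are the convolution `g * f`. -/
theorem comp_rightHit_eq_comp_leftHit (f g : C →ₗ[k] k) :
    g ∘ₗ rightHit f = f ∘ₗ leftHit g := by
  ext x
  have h₁ := LinearMap.congr_fun (counit_comp_leftHit g) (rightHit f x)
  have h₂ := LinearMap.congr_fun (counit_comp_rightHit f) (leftHit g x)
  rw [LinearMap.comp_apply] at h₁ h₂
  rw [LinearMap.comp_apply, LinearMap.comp_apply, ← h₁, ← h₂, rightHit_leftHit]

theorem leftHit_comp_leftHit (f g : C →ₗ[k] k) :
    leftHit g ∘ₗ leftHit f = leftHit (g ∘ₗ leftHit f) := by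
  ext x
  have h := LinearMap.congr_fun (comul_comp_leftHit f) x
  simp only [LinearMap.comp_apply] at h
  change TensorProduct.lid k C (g.rTensor C (comul (leftHit f x))) =
    TensorProduct.lid k C ((g ∘ₗ leftHit f).rTensor C (comul x))
  rw [h, LinearMap.rTensor_comp, LinearMap.comp_apply]

/-- A linear map that is colinear on one side is the hit operator of its composition with the
counit. -/
theorem eq_rightHit_of_colinear {S : C →ₗ[k] C} (hS : comul ∘ₗ S = S.lTensor C ∘ₗ comul) :
    rightHit (counit ∘ₗ S) = S := by
  ext x
  have h := LinearMap.congr_fun hS x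
  simp only [LinearMap.comp_apply] at h
  rw [rightHit, LinearMap.lTensor_comp, LinearMap.comp_apply, LinearMap.comp_apply,
    LinearMap.comp_apply, ← h]
  simp

theorem leftHit_comp_leftHit_eq_id {φ ψ : C →ₗ[k] k}
    (h : rightHit φ ∘ₗ rightHit ψ = LinearMap.id) : leftHit ψ ∘ₗ leftHit φ = LinearMap.id := by
  rw [leftHit_comp_leftHit, ← comp_rightHit_eq_comp_leftHit, ← counit_comp_rightHit φ,
    LinearMap.comp_assoc, h, LinearMap.comp_id, leftHit_counit]

/-- The inner automorphism `x ↦ ψ(x₁) x₂ φ(x₃)` of a coalgebra given by mutually inverse elements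
`φ`, `ψ` of its convolution algebra. -/
def innerAut (φ ψ : C →ₗ[k] k) (h₁ : rightHit φ ∘ₗ rightHit ψ = LinearMap.id)
    (h₂ : rightHit ψ ∘ₗ rightHit φ = LinearMap.id) : C ≃ₗc[k] C :=
  { (LinearEquiv.ofLinearMap (leftHit ψ ∘ₗ rightHit φ) (leftHit φ ∘ₗ rightHit ψ)
      (by
        ext x
        have h₃ := LinearMap.congr_fun (leftHit_comp_leftHit_eq_id h₁) x
        have h₄ := LinearMap.congr_fun h₁ x
        simp only [LinearMap.comp_apply, LinearMap.id_apply] at h₃ h₄ ⊢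
        rw [rightHit_leftHit, h₄, h₃])
      (by
        ext x
        have h₃ := LinearMap.congr_fun (leftHit_comp_leftHit_eq_id h₂) x
        have h₄ := LinearMap.congr_fun h₂ x
        simp only [LinearMap.comp_apply, LinearMap.id_apply] at h₃ h₄ ⊢
        rw [rightHit_leftHit, h₄, h₃]) : C ≃ₗ[k] C) with
    counit_comp := by
      ext x
      have h₃ := LinearMap.congr_fun (leftHit_comp_leftHit_eq_id h₂) x
      have h₄ := LinearMap.congr_fun (counit_comp_rightHit φ) (leftHit ψ x)
      have h₅ := LinearMap.congr_fun (counit_comp_leftHit φ) (leftHit ψ x)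
      simp only [LinearMap.comp_apply, LinearMap.id_apply] at h₃ h₄ h₅
      change counit (leftHit ψ (rightHit φ x)) = counit x
      rw [← rightHit_leftHit, h₄, ← h₅, h₃]
    map_comp_comul := by
      -- `(σ ⊗ σ)Δ = (L_ψ ⊗ R_φ)(R_φ ⊗ L_ψ)Δ`, and the middle factors cancel
      have key : TensorProduct.map (rightHit φ) (leftHit ψ) ∘ₗ comul = comul := by
        have e : TensorProduct.map (rightHit φ) (leftHit ψ) =
          (leftHit ψ).lTensor C ∘ₗ (rightHit φ).rTensor C := by ext; simp
        rw [e, LinearMap.comp_assoc, rTensor_rightHit_comp_comul, ← LinearMap.comp_assoc,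
          ← LinearMap.lTensor_comp, leftHit_comp_leftHit_eq_id h₁, LinearMap.lTensor_id,
          LinearMap.id_comp]
      have e : TensorProduct.map (leftHit ψ ∘ₗ rightHit φ) (leftHit ψ ∘ₗ rightHit φ) =
          TensorProduct.map (leftHit ψ) (rightHit φ) ∘ₗ
            TensorProduct.map (rightHit φ) (leftHit ψ) := by
        ext; simp [rightHit_leftHit]
      change TensorProduct.map (leftHit ψ ∘ₗ rightHit φ) (leftHit ψ ∘ₗ rightHit φ) ∘ₗ comul =
        comul ∘ₗ leftHit ψ ∘ₗ rightHit φ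
      have e' : TensorProduct.map (leftHit ψ) (rightHit φ) =
          (leftHit ψ).rTensor C ∘ₗ (rightHit φ).lTensor C := by ext; simp
      rw [e, LinearMap.comp_assoc, key, e', ← LinearMap.comp_assoc, comul_comp_leftHit,
        LinearMap.comp_assoc, LinearMap.comp_assoc, comul_comp_rightHit] }

theorem innerAut_apply (φ ψ : C →ₗ[k] k) (h₁ : rightHit φ ∘ₗ rightHit ψ = LinearMap.id)
    (h₂ : rightHit ψ ∘ₗ rightHit φ = LinearMap.id) (x : C) :
    innerAut φ ψ h₁ h₂ x = leftHit ψ (rightHit φ x) := rfl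

end HitActions

/-- Coassociativity, with a linear map applied in each of the three tensor factors. -/
theorem map_map_comul {k : Type w} [Field k] {C : Type u} [AddCommGroup C] [Module k C]
    [Coalgebra k C] {A₁ A₂ A₃ : Type*} [AddCommGroup A₁] [Module k A₁] [AddCommGroup A₂]
    [Module k A₂] [AddCommGroup A₃] [Module k A₃] (f : C →ₗ[k] A₁) (g : C →ₗ[k] A₂)
    (h : C →ₗ[k] A₃) (x : C) :
    TensorProduct.map f (TensorProduct.map g h ∘ₗ comul) (comul x) =
      TensorProduct.assoc k A₁ A₂ A₃ (TensorProduct.map (TensorProduct.map f g ∘ₗ comul) h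
        (comul x)) := by
  have e₁ : TensorProduct.map f (TensorProduct.map g h ∘ₗ comul) =
      TensorProduct.map f (TensorProduct.map g h) ∘ₗ comul.lTensor C := by
    ext; simp
  have e₂ : TensorProduct.map (TensorProduct.map f g ∘ₗ comul) h =
      TensorProduct.map (TensorProduct.map f g) h ∘ₗ comul.rTensor C := by
    ext; simp
  have e₃ : TensorProduct.map f (TensorProduct.map g h) ∘ₗ
      (TensorProduct.assoc k C C C).toLinearMap =
      (TensorProduct.assoc k A₁ A₂ A₃).toLinearMap ∘ₗ
        TensorProduct.map (TensorProduct.map f g) h := by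
    ext; simp
  have h₃ := LinearMap.congr_fun e₃ (comul.rTensor C (comul x))
  simp only [LinearMap.comp_apply, LinearEquiv.coe_coe, coassoc_apply] at h₃
  rw [e₁, e₂, LinearMap.comp_apply, LinearMap.comp_apply, h₃]

/-! ### Linear maps on a subcoalgebra -/

section Subcoalgebra

variable {k : Type w} [Field k] {C : Type u} [AddCommGroup C] [Module k C] [Coalgebra k C]
  {A B A' B' : Type*} [AddCommGroup A] [Module k A] [AddCommGroup B] [Module k B]

/-- On `Δ(x)` with `x` in a subcoalgebra, a tensor product of two maps depends only on the
restrictions of the maps to the subcoalgebra. -/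
theorem map_comul_congr (M : Subcoalgebra k C) {f f' : C →ₗ[k] A} {g g' : C →ₗ[k] B}
    (hf : ∀ x ∈ M.toSubmodule, f x = f' x) (hg : ∀ x ∈ M.toSubmodule, g x = g' x)
    {x : C} (hx : x ∈ M.toSubmodule) :
    TensorProduct.map f g (comul x) = TensorProduct.map f' g' (comul x) := by
  obtain ⟨z, hz⟩ := M.comul_mem x hx
  have e₁ : f ∘ₗ M.toSubmodule.subtype = f' ∘ₗ M.toSubmodule.subtype := by
    ext y; exact hf y y.2
  have e₂ : g ∘ₗ M.toSubmodule.subtype = g' ∘ₗ M.toSubmodule.subtype := by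
    ext y; exact hg y y.2
  rw [← hz, ← LinearMap.comp_apply, ← LinearMap.comp_apply, ← TensorProduct.map_comp,
    ← TensorProduct.map_comp, e₁, e₂]

theorem rightHit_mem (M : Subcoalgebra k C) (f : C →ₗ[k] k) {x : C} (hx : x ∈ M.toSubmodule) :
    rightHit f x ∈ M.toSubmodule := by
  obtain ⟨z, hz⟩ := M.comul_mem x hx
  rw [rightHit, LinearMap.comp_apply, LinearMap.comp_apply, ← hz]
  clear hz
  induction z with
  | zero => simp
  | add a b ha hb => simpa only [map_add] using Submodule.add_mem _ ha hb
  | tmul a b => simpa using M.toSubmodule.smul_mem _ a.2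

theorem leftHit_mem (M : Subcoalgebra k C) (f : C →ₗ[k] k) {x : C} (hx : x ∈ M.toSubmodule) :
    leftHit f x ∈ M.toSubmodule := by
  obtain ⟨z, hz⟩ := M.comul_mem x hx
  rw [leftHit, LinearMap.comp_apply, LinearMap.comp_apply, ← hz]
  clear hz
  induction z with
  | zero => simp
  | add a b ha hb => simpa only [map_add] using Submodule.add_mem _ ha hb
  | tmul a b => simpa using M.toSubmodule.smul_mem _ b.2

theorem rightHit_eq_self (M : Subcoalgebra k C) {f : C →ₗ[k] k}
    (hf : ∀ x ∈ M.toSubmodule, f x = counit x) {x : C} (hx : x ∈ M.toSubmodule) :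
    rightHit f x = x := by
  have h := map_comul_congr M (f := LinearMap.id) (f' := LinearMap.id) (fun _ _ => rfl) hf hx
  change TensorProduct.rid k C (TensorProduct.map LinearMap.id f (comul x)) = x
  rw [h]
  exact LinearMap.congr_fun rightHit_counit x

theorem leftHit_eq_self (M : Subcoalgebra k C) {f : C →ₗ[k] k}
    (hf : ∀ x ∈ M.toSubmodule, f x = counit x) {x : C} (hx : x ∈ M.toSubmodule) :
    leftHit f x = x := by
  have h := map_comul_congr M (g := LinearMap.id) (g' := LinearMap.id) hf (fun _ _ => rfl) hx
  change TensorProduct.lid k C (TensorProduct.map f LinearMap.id (comul x)) = x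
  rw [h]
  exact LinearMap.congr_fun leftHit_counit x

/-- The sum of two subcoalgebras. -/
def Subcoalgebra.sup (M N : Subcoalgebra k C) : Subcoalgebra k C where
  toSubmodule := M.toSubmodule ⊔ N.toSubmodule
  comul_mem x hx := by
    have mono : ∀ {S T : Submodule k C}, S ≤ T →
        LinearMap.range (TensorProduct.map S.subtype S.subtype) ≤
          LinearMap.range (TensorProduct.map T.subtype T.subtype) := by
      rintro S T h _ ⟨z, rfl⟩
      refine ⟨TensorProduct.map (Submodule.inclusion h) (Submodule.inclusion h) z, ?_⟩
      rw [← LinearMap.comp_apply, ← TensorProduct.map_comp]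
      rfl
    obtain ⟨y, hy, z, hz, rfl⟩ := Submodule.mem_sup.1 hx
    rw [map_add]
    exact Submodule.add_mem _ (mono le_sup_left (M.comul_mem y hy))
      (mono le_sup_right (N.comul_mem z hz))

/-- The restriction of a coalgebra automorphism of `C` to a subcoalgebra that it maps onto
itself. -/
def restrictAut (M : Subcoalgebra k C) (σ : C ≃ₗc[k] C)
    (h : M.toSubmodule.map ((σ : C ≃ₗ[k] C) : C →ₗ[k] C) = M.toSubmodule) : M ≃ₗc[k] M :=
  { (σ : C ≃ₗ[k] C).ofSubmodules M.toSubmodule M.toSubmodule h with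
    counit_comp := by
      ext x
      exact LinearMap.congr_fun (σ.toCoalgHom.counit_comp) (x : C)
    map_comp_comul := by
      ext x
      refine M.map_subtype_injective ?_
      let r : M →ₗ[k] M := ((σ : C ≃ₗ[k] C).ofSubmodules M.toSubmodule M.toSubmodule h).toLinearMap
      change TensorProduct.map M.toSubmodule.subtype M.toSubmodule.subtype
        (TensorProduct.map r r (M.comulAux x)) =
          TensorProduct.map M.toSubmodule.subtype M.toSubmodule.subtype (M.comulAux (r x))
      have e : M.toSubmodule.subtype ∘ₗ r =
        ((σ : C ≃ₗ[k] C) : C →ₗ[k] C) ∘ₗ M.toSubmodule.subtype := rfl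
      have h₁ := LinearMap.congr_fun M.map_comulAux x
      have h₂ := LinearMap.congr_fun M.map_comulAux (r x)
      have h₃ := LinearMap.congr_fun (σ.toCoalgHom.map_comp_comul) (x : C)
      simp only [LinearMap.comp_apply] at h₁ h₂ h₃
      rw [h₂, ← LinearMap.comp_apply, ← TensorProduct.map_comp, e, TensorProduct.map_comp,
        LinearMap.comp_apply, h₁]
      exact h₃ }

/-- A linear map extending an automorphism of a subcoalgebra is comultiplicative there. -/
theorem map_comul_of_extends {M : Subcoalgebra k C} (τ : M ≃ₗc[k] M) {t : C →ₗ[k] C}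
    (ht : ∀ x : M, t x = τ x) {x : C} (hx : x ∈ M.toSubmodule) :
    comul (t x) = TensorProduct.map t t (comul x) := by
  let r : M →ₗ[k] M := τ.toCoalgHom.toLinearMap
  have e : t ∘ₗ M.toSubmodule.subtype = M.toSubmodule.subtype ∘ₗ r := LinearMap.ext ht
  have h₁ := LinearMap.congr_fun M.map_comulAux ⟨x, hx⟩
  have h₂ := LinearMap.congr_fun M.map_comulAux (r ⟨x, hx⟩)
  have h₃ : TensorProduct.map r r (M.comulAux ⟨x, hx⟩) = M.comulAux (r ⟨x, hx⟩) :=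
    LinearMap.congr_fun (τ.toCoalgHom.map_comp_comul) (⟨x, hx⟩ : M)
  have h₄ : t x = (r ⟨x, hx⟩ : C) := ht ⟨x, hx⟩
  simp only [LinearMap.comp_apply, Submodule.subtype_apply] at h₁ h₂
  rw [h₄, ← h₁, ← h₂, ← h₃, ← LinearMap.comp_apply, ← TensorProduct.map_comp, ← e,
    TensorProduct.map_comp, LinearMap.comp_apply]

end Subcoalgebra

/-! ### Paths, their lengths and their concatenation -/

section Paths

variable {k : Type w} [Field k] {Q : Type u} [Quiver.{v} Q]

theorem length_add_length_of_mem_splits {a b : Q} {p : Quiver.Path a b}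
    {s : Σ c : Q, Quiver.Path a c × Quiver.Path c b} (hs : s ∈ splits p) :
    s.2.1.length + s.2.2.length = p.length := by
  induction p with
  | nil =>
    rw [splits, List.mem_singleton] at hs
    subst hs; rfl
  | cons p α ih =>
    rw [splits, List.mem_append, List.mem_map, List.mem_singleton] at hs
    rcases hs with ⟨t, ht, rfl⟩ | rfl
    · have := ih ht
      simp only [Quiver.Path.length_cons]
      omega
    · simp

theorem map_comul_ofPath_mem {X : Type*} [AddCommGroup X] [Module k X] (S : Submodule k X)
    (h : PathCoalgebra k Q ⊗[k] PathCoalgebra k Q →ₗ[k] X) {a b : Q} (p : Quiver.Path a b)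
    (H : ∀ (c : Q) (q : Quiver.Path a c) (r : Quiver.Path c b),
      q.length + r.length = p.length → h (ofPath k q ⊗ₜ[k] ofPath k r) ∈ S) :
    h (comul (ofPath k p)) ∈ S := by
  rw [comul_ofPath, map_list_sum, List.map_map]
  refine list_sum_mem fun y hy => ?_
  obtain ⟨s, hs, rfl⟩ := List.mem_map.1 hy
  exact H _ _ _ (length_add_length_of_mem_splits hs)

theorem map_comul_ofPath_congr {X : Type*} [AddCommGroup X] [Module k X]
    (h h' : PathCoalgebra k Q ⊗[k] PathCoalgebra k Q →ₗ[k] X) {a b : Q} (p : Quiver.Path a b)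
    (H : ∀ (c : Q) (q : Quiver.Path a c) (r : Quiver.Path c b), q.length + r.length = p.length →
      h (ofPath k q ⊗ₜ[k] ofPath k r) = h' (ofPath k q ⊗ₜ[k] ofPath k r)) :
    h (comul (ofPath k p)) = h' (comul (ofPath k p)) := by
  refine sub_eq_zero.1 ((Submodule.mem_bot k).1 ?_)
  rw [← LinearMap.sub_apply]
  refine map_comul_ofPath_mem ⊥ (h - h') p fun c q r hqr => ?_
  rw [Submodule.mem_bot, LinearMap.sub_apply, H c q r hqr, sub_self]

theorem tensor_hom_ext_path {X : Type*} [AddCommGroup X] [Module k X]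
    {f g : PathCoalgebra k Q ⊗[k] PathCoalgebra k Q →ₗ[k] X}
    (h : ∀ (a b c d : Q) (p : Quiver.Path a b) (q : Quiver.Path c d),
      f (ofPath k p ⊗ₜ[k] ofPath k q) = g (ofPath k p ⊗ₜ[k] ofPath k q)) : f = g :=
  TensorProduct.ext (hom_ext_path fun a b p => hom_ext_path fun c d q => h a b c d p q)

variable (k Q) in
/-- The span of the paths of length less than `n`. -/
def lengthLT (n : ℕ) : Submodule k (PathCoalgebra k Q) :=
  Submodule.span k {x | ∃ (a b : Q) (p : Quiver.Path a b), p.length < n ∧ ofPath k p = x}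

theorem ofPath_mem_lengthLT {n : ℕ} {a b : Q} {p : Quiver.Path a b} (h : p.length < n) :
    ofPath k p ∈ lengthLT k Q n :=
  Submodule.subset_span ⟨a, b, p, h, rfl⟩

theorem lengthLT_mono {m n : ℕ} (h : m ≤ n) : lengthLT k Q m ≤ lengthLT k Q n := by
  refine Submodule.span_le.2 ?_
  rintro _ ⟨a, b, p, hp, rfl⟩
  exact ofPath_mem_lengthLT (hp.trans_le h)

theorem path_induction {motive : PathCoalgebra k Q → Prop} (x : PathCoalgebra k Q)
    (zero : motive 0) (add : ∀ x y, motive x → motive y → motive (x + y))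
    (smul : ∀ (c : k) {a b : Q} (p : Quiver.Path a b), motive (c • ofPath k p)) : motive x := by
  refine Finsupp.induction_linear (motive := fun y : AllPaths Q →₀ k => motive y) x zero add ?_
  rintro ⟨a, b, p⟩ c
  have : (Finsupp.single ⟨a, b, p⟩ c : AllPaths Q →₀ k) = (c • ofPath k p : PathCoalgebra k Q) :=
    ((Finsupp.smul_single _ _ _).trans (congrArg _ (mul_one c))).symm
  exact this ▸ smul c p

theorem exists_mem_lengthLT (x : PathCoalgebra k Q) : ∃ n, x ∈ lengthLT k Q n := by
  induction x using path_induction with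
  | zero => exact ⟨0, Submodule.zero_mem _⟩
  | add x y hx hy =>
    obtain ⟨m, hm⟩ := hx
    obtain ⟨n, hn⟩ := hy
    exact ⟨max m n, Submodule.add_mem _ (lengthLT_mono (le_max_left _ _) hm)
      (lengthLT_mono (le_max_right _ _) hn)⟩
  | smul c p =>
    exact ⟨p.length + 1, Submodule.smul_mem _ _ (ofPath_mem_lengthLT (Nat.lt_succ_self _))⟩

theorem map_eq_zero_of_mem_lengthLT {X : Type*} [AddCommGroup X] [Module k X]
    {f : PathCoalgebra k Q →ₗ[k] X} {n : ℕ}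
    (hf : ∀ (a b : Q) (p : Quiver.Path a b), p.length < n → f (ofPath k p) = 0)
    {x : PathCoalgebra k Q} (hx : x ∈ lengthLT k Q n) : f x = 0 := by
  have h : lengthLT k Q n ≤ LinearMap.ker f := by
    refine Submodule.span_le.2 ?_
    rintro _ ⟨a, b, p, hp, rfl⟩
    exact hf a b p hp
  exact h hx

/-- `1 + N` is bijective when `N` sends every path to a combination of shorter ones. -/
theorem bijective_id_add_of_lowering {N : PathCoalgebra k Q →ₗ[k] PathCoalgebra k Q}
    (hN : ∀ (a b : Q) (p : Quiver.Path a b), N (ofPath k p) ∈ lengthLT k Q p.length) :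
    Function.Bijective
      (LinearMap.id + N : PathCoalgebra k Q →ₗ[k] PathCoalgebra k Q) := by
  have hN' : ∀ n, ∀ x ∈ lengthLT k Q (n + 1), N x ∈ lengthLT k Q n := by
    intro n x hx
    have h : lengthLT k Q (n + 1) ≤ (lengthLT k Q n).comap N := by
      refine Submodule.span_le.2 ?_
      rintro _ ⟨a, b, p, hp, rfl⟩
      exact lengthLT_mono (Nat.lt_succ_iff.1 hp) (hN a b p)
    exact h hx
  constructor
  · refine (injective_iff_map_eq_zero (LinearMap.id + N)).2 fun x hx => ?_
    have hx' : x = -N x := eq_neg_of_add_eq_zero_left hx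
    obtain ⟨n, hn⟩ := exists_mem_lengthLT x
    induction n with
    | zero =>
      have hid : (LinearMap.id : PathCoalgebra k Q →ₗ[k] PathCoalgebra k Q) x = 0 :=
        map_eq_zero_of_mem_lengthLT (by simp) hn
      exact hid
    | succ n ih =>
      refine ih ?_
      rw [hx']
      exact Submodule.neg_mem _ (hN' n x hn)
  · have key : ∀ n, lengthLT k Q n ≤ LinearMap.range (LinearMap.id + N) := by
      intro n
      induction n with
      | zero =>
        refine Submodule.span_le.2 ?_
        rintro _ ⟨a, b, p, hp, rfl⟩
        exact absurd hp (Nat.not_lt_zero _)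
      | succ n ih =>
        refine Submodule.span_le.2 ?_
        rintro _ ⟨a, b, p, hp, rfl⟩
        have h₁ : N (ofPath k p) ∈ LinearMap.range (LinearMap.id + N) :=
          ih (hN' n _ (ofPath_mem_lengthLT hp))
        have h₂ := Submodule.sub_mem _ (LinearMap.mem_range_self (LinearMap.id + N) (ofPath k p)) h₁
        simpa using h₂
    intro x
    obtain ⟨n, hn⟩ := exists_mem_lengthLT x
    exact key n hn

variable (k Q) in
/-- The projection onto the span of the paths of length `n`. -/
def lengthProj (n : ℕ) : PathCoalgebra k Q →ₗ[k] PathCoalgebra k Q :=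
  liftPath k fun p => if p.length = n then ofPath k p else 0

theorem lengthProj_ofPath (n : ℕ) {a b : Q} (p : Quiver.Path a b) :
    lengthProj k Q n (ofPath k p) = if p.length = n then ofPath k p else 0 :=
  liftPath_ofPath _ p

open Classical in
variable (k Q) in
/-- The concatenation product of the path algebra, which is zero on paths that do not compose. -/
def pathMul : PathCoalgebra k Q ⊗[k] PathCoalgebra k Q →ₗ[k] PathCoalgebra k Q :=
  TensorProduct.lift (liftPath k fun {_ b} p => liftPath k fun {c _} q =>
    if h : b = c then ofPath k (p.comp (q.cast h.symm rfl)) else 0)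

theorem pathMul_ofPath {a b c : Q} (p : Quiver.Path a b) (q : Quiver.Path b c) :
    pathMul k Q (ofPath k p ⊗ₜ[k] ofPath k q) = ofPath k (p.comp q) := by
  simp [pathMul]

theorem pathMul_ofPath_of_ne {a b c d : Q} (p : Quiver.Path a b) (q : Quiver.Path c d)
    (h : b ≠ c) : pathMul k Q (ofPath k p ⊗ₜ[k] ofPath k q) = 0 := by
  simp [pathMul, h]

theorem map_lengthProj_zero_comul {a b : Q} (p : Quiver.Path a b) :
    TensorProduct.map LinearMap.id (lengthProj k Q 0) (comul (ofPath k p)) =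
      ofPath k p ⊗ₜ[k] ofPath k (Quiver.Path.nil : Quiver.Path b b) := by
  cases p with
  | nil => simp [comul_ofPath, splits, lengthProj_ofPath]
  | cons p α =>
    simp [comul_ofPath, splits, lengthProj_ofPath, map_list_sum, Function.comp_def]

/-- `x = π₀(x) + ∑ x₁ π₁(x₂)`: a nontrivial path is a shorter path followed by an arrow. -/
theorem eq_lengthProj_zero_add (x : PathCoalgebra k Q) :
    x = lengthProj k Q 0 x +
      pathMul k Q (TensorProduct.map LinearMap.id (lengthProj k Q 1) (comul x)) := by
  suffices h : LinearMap.id = lengthProj k Q 0 +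
      pathMul k Q ∘ₗ TensorProduct.map LinearMap.id (lengthProj k Q 1) ∘ₗ comul from
    LinearMap.congr_fun h x
  refine hom_ext_path fun a b p => ?_
  cases p with
  | nil => simp [comul_ofPath, splits, lengthProj_ofPath]
  | @cons c _ p α =>
    have h : ∀ {d : Q} (q : Quiver.Path a d) (r : Quiver.Path d c),
        pathMul k Q (ofPath k q ⊗ₜ[k] lengthProj k Q 1 (ofPath k (r.cons α))) =
          (if r.length = 0 then (1 : k) else 0) •
            pathMul k Q (ofPath k q ⊗ₜ[k] ofPath k (Quiver.Path.nil.cons α)) := by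
      intro d q r
      cases r with
      | nil => simp [lengthProj_ofPath]
      | cons r β => simp [lengthProj_ofPath]
    have h' := sum_splits_right (k := k) p (fun q =>
      pathMul k Q (ofPath k q ⊗ₜ[k] ofPath k (Quiver.Path.nil.cons α)))
    rw [pathMul_ofPath] at h'
    simp only [LinearMap.add_apply, LinearMap.comp_apply, comul_ofPath, splits, List.map_append,
      List.map_map, Function.comp_def, List.sum_append, map_add, map_list_sum,
      TensorProduct.map_tmul, LinearMap.id_apply, h, h']
    simp [lengthProj_ofPath]

/-- The comultiplication of a product `x α`, with `α` a combination of arrows. -/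
theorem comul_pathMul_lengthProj_one (z : PathCoalgebra k Q ⊗[k] PathCoalgebra k Q) :
    comul (pathMul k Q ((lengthProj k Q 1).lTensor _ z)) =
      (pathMul k Q).lTensor (PathCoalgebra k Q) (TensorProduct.assoc k _ _ _
        (TensorProduct.map comul (lengthProj k Q 1) z)) +
      TensorProduct.map LinearMap.id (lengthProj k Q 0)
        (comul (pathMul k Q ((lengthProj k Q 1).lTensor _ z))) := by
  suffices h : comul ∘ₗ pathMul k Q ∘ₗ (lengthProj k Q 1).lTensor _ =
      (pathMul k Q).lTensor (PathCoalgebra k Q) ∘ₗ (TensorProduct.assoc k _ _ _).toLinearMap ∘ₗ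
        TensorProduct.map comul (lengthProj k Q 1) +
      TensorProduct.map LinearMap.id (lengthProj k Q 0) ∘ₗ
        comul ∘ₗ pathMul k Q ∘ₗ (lengthProj k Q 1).lTensor _ from LinearMap.congr_fun h z
  refine tensor_hom_ext_path fun a b c d p q => ?_
  simp only [LinearMap.add_apply, LinearMap.comp_apply, LinearMap.lTensor_tmul,
    TensorProduct.map_tmul, lengthProj_ofPath, LinearEquiv.coe_coe]
  match q with
  | .nil => simp
  | .cons (.cons q β) α => simp
  | .cons .nil α =>
    simp only [Quiver.Path.length_cons, Quiver.Path.length_nil, zero_add, if_true]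
    by_cases hbc : b = c
    · subst hbc
      rw [pathMul_ofPath, map_lengthProj_zero_comul, comul_ofPath, comul_ofPath, list_sum_tmul]
      simp only [Quiver.Path.comp_cons, Quiver.Path.comp_nil, splits, List.map_append, List.map_map,
        Function.comp_def, List.sum_append, map_list_sum, TensorProduct.assoc_tmul,
        LinearMap.lTensor_tmul, pathMul_ofPath]
      simp
    · rw [pathMul_ofPath_of_ne _ _ hbc, comul_ofPath, list_sum_tmul]
      simp [map_list_sum, Function.comp_def, pathMul_ofPath_of_ne _ _ hbc]

/-- The right vertex of a product is the right vertex of its second factor. -/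
theorem map_lengthProj_zero_comul_pathMul (z : PathCoalgebra k Q ⊗[k] PathCoalgebra k Q) :
    TensorProduct.map LinearMap.id (lengthProj k Q 0) (comul (pathMul k Q z)) =
      (pathMul k Q).rTensor (PathCoalgebra k Q) ((TensorProduct.assoc k _ _ _).symm
        (TensorProduct.map LinearMap.id
          (TensorProduct.map LinearMap.id (lengthProj k Q 0) ∘ₗ comul) z)) := by
  suffices h : TensorProduct.map LinearMap.id (lengthProj k Q 0) ∘ₗ comul ∘ₗ pathMul k Q =
      (pathMul k Q).rTensor (PathCoalgebra k Q) ∘ₗ (TensorProduct.assoc k _ _ _).symm.toLinearMap ∘ₗ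
        TensorProduct.map LinearMap.id
          (TensorProduct.map LinearMap.id (lengthProj k Q 0) ∘ₗ comul) from LinearMap.congr_fun h z
  refine tensor_hom_ext_path fun a b c d p q => ?_
  by_cases hbc : b = c
  · subst hbc
    simp [pathMul_ofPath, map_lengthProj_zero_comul]
  · simp [pathMul_ofPath_of_ne _ _ hbc, map_lengthProj_zero_comul]

theorem comul_lengthProj_zero (x : PathCoalgebra k Q) :
    comul (lengthProj k Q 0 x) =
      TensorProduct.map (lengthProj k Q 0) (lengthProj k Q 0) (comul x) := by
  suffices h : comul ∘ₗ lengthProj k Q 0 =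
      TensorProduct.map (lengthProj k Q 0) (lengthProj k Q 0) ∘ₗ comul from LinearMap.congr_fun h x
  refine hom_ext_path fun a b p => ?_
  cases p with
  | nil => simp [comul_ofPath, splits, lengthProj_ofPath]
  | cons p α =>
    simp [comul_ofPath, splits, lengthProj_ofPath, map_list_sum, Function.comp_def]

theorem lengthProj_zero_lengthProj_zero (x : PathCoalgebra k Q) :
    lengthProj k Q 0 (lengthProj k Q 0 x) = lengthProj k Q 0 x := by
  suffices h : lengthProj k Q 0 ∘ₗ lengthProj k Q 0 = lengthProj k Q 0 from LinearMap.congr_fun h x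
  refine hom_ext_path fun a b p => ?_
  by_cases h : p.length = 0 <;> simp [lengthProj_ofPath, h]

theorem counit_lengthProj_zero (x : PathCoalgebra k Q) :
    counit (R := k) (lengthProj k Q 0 x) = counit x := by
  suffices h : counit ∘ₗ lengthProj k Q 0 = (counit : PathCoalgebra k Q →ₗ[k] k) from
    LinearMap.congr_fun h x
  refine hom_ext_path fun a b p => ?_
  by_cases h : p.length = 0 <;> simp [lengthProj_ofPath, counit_ofPath, h]

end Paths

/-! ### Inner automorphisms and their fixed points -/

section Inner

variable {k : Type w} [Field k] {Q : Type u} [Quiver.{v} Q]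

/-- A functional that takes the value `1` on all vertices is invertible for the convolution
product. -/
theorem exists_convolution_inverse {φ : PathCoalgebra k Q →ₗ[k] k}
    (hφ : ∀ a : Q, φ (ofPath k (Quiver.Path.nil : Quiver.Path a a)) = 1) :
    ∃ ψ : PathCoalgebra k Q →ₗ[k] k, rightHit φ ∘ₗ rightHit ψ = LinearMap.id ∧
      rightHit ψ ∘ₗ rightHit φ = LinearMap.id := by
  have hφ' : rightHit φ = LinearMap.id + rightHit (φ - counit) := by
    rw [← rightHit_counit, ← rightHit_add, add_sub_cancel]
  have hb : Function.Bijective (rightHit φ) := by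
    rw [hφ']
    refine bijective_id_add_of_lowering fun a b p => ?_
    refine map_comul_ofPath_mem _ ((TensorProduct.rid k _).toLinearMap ∘ₗ
      (φ - counit).lTensor _) p fun c q r hqr => ?_
    match r, hqr with
    | .nil, _ => simp [hφ, counit_ofPath]
    | .cons r α, hqr =>
      simp only [Quiver.Path.length_cons] at hqr
      have hq : ofPath k q ∈ lengthLT k Q p.length := ofPath_mem_lengthLT (by omega)
      simpa [sub_smul] using Submodule.sub_mem _
        (Submodule.smul_mem _ (φ (ofPath k (r.cons α))) hq)
        (Submodule.smul_mem _ (counit (R := k) (ofPath k (r.cons α))) hq)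
  let S := LinearEquiv.ofBijective (rightHit φ) hb
  have hS₁ : rightHit φ ∘ₗ S.symm.toLinearMap = LinearMap.id :=
    LinearMap.ext fun x => S.apply_symm_apply x
  have hS₂ : S.symm.toLinearMap ∘ₗ rightHit φ = LinearMap.id :=
    LinearMap.ext fun x => S.symm_apply_apply x
  have hS : comul ∘ₗ S.symm.toLinearMap = S.symm.toLinearMap.lTensor _ ∘ₗ comul := by
    have h := congrArg (fun F => S.symm.toLinearMap.lTensor (PathCoalgebra k Q) ∘ₗ F ∘ₗ
      S.symm.toLinearMap) (comul_comp_rightHit φ)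
    simp only [LinearMap.comp_assoc, hS₁, LinearMap.comp_id] at h
    rw [h, ← LinearMap.comp_assoc, ← LinearMap.lTensor_comp, hS₂, LinearMap.lTensor_id,
      LinearMap.id_comp]
  refine ⟨counit ∘ₗ S.symm.toLinearMap, ?_, ?_⟩
  · rw [eq_rightHit_of_colinear hS, hS₁]
  · rw [eq_rightHit_of_colinear hS, hS₂]

/-- If `φ` agrees with the counit on a subcoalgebra, so does its convolution inverse. -/
theorem inverse_eq_counit (M : Subcoalgebra k (PathCoalgebra k Q))
    {φ ψ : PathCoalgebra k Q →ₗ[k] k} (h : rightHit ψ ∘ₗ rightHit φ = LinearMap.id)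
    (hφ : ∀ x ∈ M.toSubmodule, φ x = counit x) {x : PathCoalgebra k Q} (hx : x ∈ M.toSubmodule) :
    ψ x = counit x := by
  have h₁ := LinearMap.congr_fun h x
  rw [LinearMap.comp_apply, rightHit_eq_self M hφ hx, LinearMap.id_apply] at h₁
  rw [← LinearMap.congr_fun (counit_comp_rightHit ψ) x, LinearMap.comp_apply, h₁]

theorem innerAut_eq_self (M : Subcoalgebra k (PathCoalgebra k Q))
    {φ ψ : PathCoalgebra k Q →ₗ[k] k} (h₁ : rightHit φ ∘ₗ rightHit ψ = LinearMap.id)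
    (h₂ : rightHit ψ ∘ₗ rightHit φ = LinearMap.id)
    (hφ : ∀ x ∈ M.toSubmodule, φ x = counit x) {x : PathCoalgebra k Q} (hx : x ∈ M.toSubmodule) :
    innerAut φ ψ h₁ h₂ x = x := by
  rw [innerAut_apply, rightHit_eq_self M hφ hx,
    leftHit_eq_self M (fun y hy => inverse_eq_counit M h₂ hφ hy) hx]

theorem innerAut_mem (M : Subcoalgebra k (PathCoalgebra k Q))
    {φ ψ : PathCoalgebra k Q →ₗ[k] k} (h₁ : rightHit φ ∘ₗ rightHit ψ = LinearMap.id)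
    (h₂ : rightHit ψ ∘ₗ rightHit φ = LinearMap.id) {x : PathCoalgebra k Q}
    (hx : x ∈ M.toSubmodule) : innerAut φ ψ h₁ h₂ x ∈ M.toSubmodule :=
  leftHit_mem M ψ (rightHit_mem M φ hx)

/-- Inner automorphisms map every subcoalgebra onto itself. -/
theorem map_innerAut (M : Subcoalgebra k (PathCoalgebra k Q))
    {φ ψ : PathCoalgebra k Q →ₗ[k] k} (h₁ : rightHit φ ∘ₗ rightHit ψ = LinearMap.id)
    (h₂ : rightHit ψ ∘ₗ rightHit φ = LinearMap.id) :
    M.toSubmodule.map (((innerAut φ ψ h₁ h₂ : PathCoalgebra k Q ≃ₗc[k] PathCoalgebra k Q) :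
      PathCoalgebra k Q ≃ₗ[k] PathCoalgebra k Q) : PathCoalgebra k Q →ₗ[k] PathCoalgebra k Q) =
      M.toSubmodule := by
  refine le_antisymm ?_ fun x hx => ?_
  · rintro _ ⟨x, hx, rfl⟩
    exact innerAut_mem M h₁ h₂ hx
  · exact ⟨(innerAut φ ψ h₁ h₂).symm x, innerAut_mem M h₂ h₁ hx,
      (innerAut φ ψ h₁ h₂).apply_symm_apply x⟩

open Classical in
variable (k) in
/-- The functional dual to the vertex `a` with respect to the basis of paths. -/
def vertexDual (a : Q) : PathCoalgebra k Q →ₗ[k] k :=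
  liftPath k fun {b _} p => if b = a ∧ p.length = 0 then 1 else 0

open Classical in
theorem rightHit_vertexDual (a : Q) {b c : Q} (p : Quiver.Path b c) :
    rightHit (vertexDual k a) (ofPath k p) = if c = a then ofPath k p else 0 := by
  rw [rightHit, LinearMap.comp_apply, LinearMap.comp_apply, comul_ofPath]
  cases p with
  | nil => by_cases h : b = a <;> simp [splits, vertexDual, h]
  | cons p α =>
    by_cases h : c = a <;>
      simp [splits, vertexDual, map_list_sum, Function.comp_def, h]

open Classical in
theorem leftHit_vertexDual (a : Q) {b c : Q} (p : Quiver.Path b c) :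
    leftHit (vertexDual k a) (ofPath k p) = if b = a then ofPath k p else 0 := by
  have h := sum_splits_left (k := k) p (fun r => if b = a then ofPath k r else 0)
  rw [← h, leftHit, LinearMap.comp_apply, LinearMap.comp_apply, comul_ofPath]
  by_cases h : b = a <;>
    simp [vertexDual, map_list_sum, Function.comp_def, h]

/-- An element lies in a subspace as soon as all its components between two vertices do. -/
theorem mem_of_components_mem {S : Submodule k (PathCoalgebra k Q)} {x : PathCoalgebra k Q}
    (h : ∀ a b : Q, leftHit (vertexDual k a) (rightHit (vertexDual k b) x) ∈ S) : x ∈ S := by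
  classical
  have key : ∃ A : Finset Q, ∀ B : Finset Q, A ⊆ B →
      x = ∑ a ∈ B, ∑ b ∈ B, leftHit (vertexDual k a) (rightHit (vertexDual k b) x) := by
    clear h
    induction x using path_induction with
    | zero => exact ⟨∅, by simp⟩
    | add x y hx hy =>
      obtain ⟨A₁, h₁⟩ := hx
      obtain ⟨A₂, h₂⟩ := hy
      refine ⟨A₁ ∪ A₂, fun B hB => ?_⟩
      conv_lhs => rw [h₁ B (Finset.union_subset_left hB), h₂ B (Finset.union_subset_right hB)]
      simp only [map_add, Finset.sum_add_distrib]
    | @smul c a b p =>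
      refine ⟨{a, b}, fun B hB => ?_⟩
      have ha : a ∈ B := hB (by simp)
      have hb : b ∈ B := hB (by simp)
      simp [rightHit_vertexDual, leftHit_vertexDual, apply_ite, ha, hb]
  obtain ⟨A, hA⟩ := key
  rw [hA A subset_rfl]
  exact Submodule.sum_mem _ fun a _ => Submodule.sum_mem _ fun b _ => h a b

/-- If `f(x₁) x₂ = x₁ f(x₂)` for all functionals `f` that vanish on a large subcoalgebra `M`, then
`x` lies in `M`. -/
theorem mem_of_hits_eq (hQ : IsAcyclic Q) {M : Subcoalgebra k (PathCoalgebra k Q)}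
    (hM : IsLarge M) {x : PathCoalgebra k Q}
    (h : ∀ f : PathCoalgebra k Q →ₗ[k] k, (∀ y ∈ M.toSubmodule, f y = 0) →
      rightHit f x = leftHit f x) : x ∈ M.toSubmodule := by
  classical
  -- pairing the hypothesis with the dual of the vertex `b`
  have key : ∀ b : Q, leftHit (vertexDual k b) x - rightHit (vertexDual k b) x ∈
      M.toSubmodule := by
    intro b
    by_contra hb
    obtain ⟨f, hf, hfM⟩ := Submodule.exists_le_ker_of_notMem hb
    have h₁ := LinearMap.congr_fun (comp_rightHit_eq_comp_leftHit f (vertexDual k b)) x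
    have h₂ := LinearMap.congr_fun (comp_rightHit_eq_comp_leftHit (vertexDual k b) f) x
    have h₃ := h f fun y hy => LinearMap.mem_ker.1 (hfM hy)
    simp only [LinearMap.comp_apply] at h₁ h₂
    rw [map_sub, ← h₁, h₂, h₃, sub_self] at hf
    exact hf rfl
  refine mem_of_components_mem fun a b => ?_
  by_cases hab : a = b
  · subst hab
    -- closed paths are trivial
    clear h key
    induction x using path_induction with
    | zero => simp
    | add x y hx hy => simpa only [map_add] using Submodule.add_mem _ hx hy
    | @smul c b d p =>
      simp only [map_smul, rightHit_vertexDual]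
      refine Submodule.smul_mem _ _ ?_
      split_ifs with hd
      · subst hd
        rw [leftHit_vertexDual]
        split_ifs with hb
        · subst hb
          exact hM _ _ p (by rw [hQ _ p]; exact Nat.zero_le _)
        · exact Submodule.zero_mem _
      · simp
  · have h₁ := leftHit_mem M (vertexDual k a) (rightHit_mem M (vertexDual k b) (key b))
    have h₂ : leftHit (vertexDual k a) ∘ₗ rightHit (vertexDual k b) ∘ₗ
        (leftHit (vertexDual k b) - rightHit (vertexDual k b)) =
        -(leftHit (vertexDual k a) ∘ₗ rightHit (vertexDual k b)) := by
      refine hom_ext_path fun c d p => ?_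
      by_cases hc : c = b <;> by_cases hd : d = b <;> by_cases hca : c = a <;>
        simp_all [rightHit_vertexDual, leftHit_vertexDual]
    have h₃ := LinearMap.congr_fun h₂ x
    simp only [LinearMap.comp_apply, LinearMap.sub_apply, LinearMap.neg_apply] at h₃
    rw [h₃] at h₁
    exact neg_mem_iff.1 h₁

end Inner

/-! ### Recursion along the length of paths -/

section Recursion

variable {k : Type w} [Field k] {Q : Type u} [Quiver.{v} Q]
  {X : Type*} [AddCommGroup X] [Module k X]

/-- The operator `K ↦ (x ↦ h(K(x₁) ⊗ θ(x₂)))` on linear maps. If `θ` vanishes on the vertices, its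
value at a path `p` involves only the values of `K` at the paths shorter than `p`. -/
def stepOp (h : X ⊗[k] PathCoalgebra k Q →ₗ[k] X) (θ : PathCoalgebra k Q →ₗ[k] PathCoalgebra k Q)
    (K : PathCoalgebra k Q →ₗ[k] X) : PathCoalgebra k Q →ₗ[k] X :=
  h ∘ₗ TensorProduct.map K θ ∘ₗ comul

variable {h : X ⊗[k] PathCoalgebra k Q →ₗ[k] X} {θ : PathCoalgebra k Q →ₗ[k] PathCoalgebra k Q}

theorem stepOp_add (K K' : PathCoalgebra k Q →ₗ[k] X) :
    stepOp h θ (K + K') = stepOp h θ K + stepOp h θ K' := by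
  simp [stepOp, TensorProduct.map_add_left, LinearMap.add_comp, LinearMap.comp_add]

theorem stepOp_sub (K K' : PathCoalgebra k Q →ₗ[k] X) :
    stepOp h θ (K - K') = stepOp h θ K - stepOp h θ K' :=
  eq_sub_of_add_eq (by rw [← stepOp_add, sub_add_cancel])

theorem stepOp_congr
    (hθ : ∀ a : Q, θ (ofPath k (Quiver.Path.nil : Quiver.Path a a)) = 0)
    {K K' : PathCoalgebra k Q →ₗ[k] X} {a b : Q} (p : Quiver.Path a b)
    (H : ∀ (c : Q) (q : Quiver.Path a c), q.length < p.length → K (ofPath k q) = K' (ofPath k q)) :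
    stepOp h θ K (ofPath k p) = stepOp h θ K' (ofPath k p) := by
  refine map_comul_ofPath_congr (h ∘ₗ TensorProduct.map K θ) (h ∘ₗ TensorProduct.map K' θ) p
    fun c q r hqr => ?_
  match r, hqr with
  | .nil, _ => simp [hθ]
  | .cons r α, hqr =>
    simp only [Quiver.Path.length_cons] at hqr
    simp [H c q (by omega)]

theorem stepOp_iterate_ofPath
    (hθ : ∀ a : Q, θ (ofPath k (Quiver.Path.nil : Quiver.Path a a)) = 0)
    (K : PathCoalgebra k Q →ₗ[k] X) (n : ℕ) :
    ∀ {a b : Q} (p : Quiver.Path a b), p.length < n → (stepOp h θ)^[n] K (ofPath k p) = 0 := by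
  induction n with
  | zero => intro a b p hp; exact absurd hp (Nat.not_lt_zero _)
  | succ n ih =>
    intro a b p hp
    rw [Function.iterate_succ_apply']
    refine (stepOp_congr hθ (K' := 0) p fun c q hq => ih q (by omega)).trans ?_
    simp [stepOp]

/-- A linear map that satisfies the homogeneous recursion on a subcoalgebra vanishes there. -/
theorem eq_zero_of_eq_stepOp
    (hθ : ∀ a : Q, θ (ofPath k (Quiver.Path.nil : Quiver.Path a a)) = 0)
    (M : Subcoalgebra k (PathCoalgebra k Q)) {K : PathCoalgebra k Q →ₗ[k] X}
    (hK : ∀ x ∈ M.toSubmodule, K x = stepOp h θ K x) :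
    ∀ x ∈ M.toSubmodule, K x = 0 := by
  have key : ∀ n, ∀ x ∈ M.toSubmodule, K x = (stepOp h θ)^[n] K x := by
    intro n
    induction n with
    | zero => intro x _; rfl
    | succ n ih =>
      intro x hx
      rw [Function.iterate_succ_apply', hK x hx]
      exact congrArg h (map_comul_congr M ih (fun _ _ => rfl) hx)
  intro x hx
  obtain ⟨n, hn⟩ := exists_mem_lengthLT x
  rw [key n x hx]
  exact map_eq_zero_of_mem_lengthLT (fun a b p hp => stepOp_iterate_ofPath hθ K n p hp) hn

/-- The recursion `G = K + stepOp h θ G` has a solution, the locally finite sum of the iterates of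
`stepOp h θ` at `K`. -/
theorem exists_eq_add_stepOp
    (hθ : ∀ a : Q, θ (ofPath k (Quiver.Path.nil : Quiver.Path a a)) = 0)
    (K : PathCoalgebra k Q →ₗ[k] X) :
    ∃ G : PathCoalgebra k Q →ₗ[k] X, G = K + stepOp h θ G := by
  let s : ℕ → PathCoalgebra k Q →ₗ[k] X := fun n => (fun F => K + stepOp h θ F)^[n] 0
  have hs : ∀ n, s (n + 1) = K + stepOp h θ (s n) := fun n => Function.iterate_succ_apply' _ _ _
  have hs_succ : ∀ n {a b : Q} (p : Quiver.Path a b), p.length < n →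
      s (n + 1) (ofPath k p) = s n (ofPath k p) := by
    intro n
    induction n with
    | zero => intro a b p hp; exact absurd hp (Nat.not_lt_zero _)
    | succ n ih =>
      intro a b p hp
      rw [hs (n + 1), hs n, LinearMap.add_apply, LinearMap.add_apply,
        stepOp_congr hθ p fun c q hq => ?_]
      rw [← hs n]
      exact ih q (by omega)
  have hs_stable : ∀ m n {a b : Q} (p : Quiver.Path a b), p.length < n → n ≤ m →
      s m (ofPath k p) = s n (ofPath k p) := by
    intro m n a b p hp hnm
    induction m, hnm using Nat.le_induction with
    | base => rfl
    | succ m hm ih => rw [hs_succ m p (by omega), ih]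
  refine ⟨liftPath k fun p => s (p.length + 1) (ofPath k p), hom_ext_path fun a b p => ?_⟩
  rw [liftPath_ofPath, hs, LinearMap.add_apply, LinearMap.add_apply]
  congr 1
  refine stepOp_congr hθ p fun c q hq => ?_
  rw [liftPath_ofPath]
  exact hs_stable _ _ q (Nat.lt_succ_self _) (by omega)

end Recursion

/-! ### Coalgebra endomorphisms with prescribed arrow part -/

section Universal

variable {k : Type w} [Field k] {Q : Type u} [Quiver.{v} Q]

/-- A coalgebra as a subcoalgebra of itself. -/
def topSubcoalgebra (k : Type w) [Field k] (C : Type u) [AddCommGroup C] [Module k C]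
    [Coalgebra k C] : Subcoalgebra k C where
  toSubmodule := ⊤
  comul_mem x _ := by
    have : Function.Surjective (TensorProduct.map (⊤ : Submodule k C).subtype
        (⊤ : Submodule k C).subtype) :=
      TensorProduct.map_surjective (fun y => ⟨⟨y, trivial⟩, rfl⟩) (fun y => ⟨⟨y, trivial⟩, rfl⟩)
    exact this _

variable {θ G : PathCoalgebra k Q →ₗ[k] PathCoalgebra k Q}

/-- A solution of the recursion respects the right end points of paths. -/
theorem lengthProj_zero_colinear_of_recursion
    (hθ : ∀ x, TensorProduct.map LinearMap.id (lengthProj k Q 0) (comul (θ x)) =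
      TensorProduct.map θ (lengthProj k Q 0) (comul x))
    (hG : G = lengthProj k Q 0 + stepOp (pathMul k Q) θ G) (x : PathCoalgebra k Q) :
    TensorProduct.map LinearMap.id (lengthProj k Q 0) (comul (G x)) =
      TensorProduct.map G (lengthProj k Q 0) (comul x) := by
  have h₁ : TensorProduct.map LinearMap.id (lengthProj k Q 0) (comul (lengthProj k Q 0 x)) =
      TensorProduct.map (lengthProj k Q 0) (lengthProj k Q 0) (comul x) := by
    rw [comul_lengthProj_zero, TensorProduct.map_map]
    congr 2
    exact LinearMap.ext lengthProj_zero_lengthProj_zero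
  have h₂ : TensorProduct.map LinearMap.id (lengthProj k Q 0)
      (comul (stepOp (pathMul k Q) θ G x)) =
      TensorProduct.map (stepOp (pathMul k Q) θ G) (lengthProj k Q 0) (comul x) := by
    have e : (TensorProduct.map LinearMap.id (lengthProj k Q 0) ∘ₗ comul) ∘ₗ θ =
      TensorProduct.map θ (lengthProj k Q 0) ∘ₗ comul := LinearMap.ext hθ
    change TensorProduct.map LinearMap.id (lengthProj k Q 0)
      (comul (pathMul k Q (TensorProduct.map G θ (comul x)))) = _
    rw [map_lengthProj_zero_comul_pathMul, TensorProduct.map_map, e, LinearMap.id_comp,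
      map_map_comul, LinearEquiv.symm_apply_apply, LinearMap.rTensor, TensorProduct.map_map]
    rfl
  conv_lhs => rw [hG]
  rw [LinearMap.add_apply, map_add, map_add, h₁, h₂, ← LinearMap.add_apply,
    ← TensorProduct.map_add_left, ← hG]

/-- A solution of the recursion is comultiplicative. -/
theorem map_comul_of_recursion
    (hθ₀ : ∀ a : Q, θ (ofPath k (Quiver.Path.nil : Quiver.Path a a)) = 0)
    (hθ₁ : ∀ x, lengthProj k Q 1 (θ x) = θ x)
    (hθ : ∀ x, TensorProduct.map LinearMap.id (lengthProj k Q 0) (comul (θ x)) =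
      TensorProduct.map θ (lengthProj k Q 0) (comul x))
    (hG : G = lengthProj k Q 0 + stepOp (pathMul k Q) θ G) (x : PathCoalgebra k Q) :
    TensorProduct.map G G (comul x) = comul (G x) := by
  -- both sides solve the same recursion, with values in `C ⊗ C`
  let h : (PathCoalgebra k Q ⊗[k] PathCoalgebra k Q) ⊗[k] PathCoalgebra k Q →ₗ[k]
      PathCoalgebra k Q ⊗[k] PathCoalgebra k Q :=
    (pathMul k Q).lTensor (PathCoalgebra k Q) ∘ₗ (TensorProduct.assoc k _ _ _).toLinearMap
  have h₁ : comul ∘ₗ G = TensorProduct.map G (lengthProj k Q 0) ∘ₗ comul +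
      stepOp h θ (comul ∘ₗ G) := by
    ext x
    have e : TensorProduct.map G θ (comul x) =
        (lengthProj k Q 1).lTensor _ (TensorProduct.map G θ (comul x)) := by
      rw [LinearMap.lTensor, TensorProduct.map_map, LinearMap.id_comp,
        show lengthProj k Q 1 ∘ₗ θ = θ from LinearMap.ext hθ₁]
    have e₁ : stepOp (pathMul k Q) θ G x = pathMul k Q ((lengthProj k Q 1).lTensor _
      (TensorProduct.map G θ (comul x))) := congrArg (pathMul k Q) e
    have e₂ : comul (stepOp (pathMul k Q) θ G x) = stepOp h θ (comul ∘ₗ G) x +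
        TensorProduct.map LinearMap.id (lengthProj k Q 0)
          (comul (stepOp (pathMul k Q) θ G x)) := by
      conv_lhs => rw [e₁, comul_pathMul_lengthProj_one, ← e₁, TensorProduct.map_map,
        show lengthProj k Q 1 ∘ₗ θ = θ from LinearMap.ext hθ₁]
      rfl
    have e₃ : comul (lengthProj k Q 0 x) =
        TensorProduct.map LinearMap.id (lengthProj k Q 0) (comul (lengthProj k Q 0 x)) := by
      rw [comul_lengthProj_zero, TensorProduct.map_map, LinearMap.id_comp,
        show lengthProj k Q 0 ∘ₗ lengthProj k Q 0 = lengthProj k Q 0 from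
          LinearMap.ext lengthProj_zero_lengthProj_zero]
    rw [LinearMap.add_apply, LinearMap.comp_apply, LinearMap.comp_apply,
      ← lengthProj_zero_colinear_of_recursion hθ hG]
    have hGx : G x = lengthProj k Q 0 x + stepOp (pathMul k Q) θ G x := LinearMap.congr_fun hG x
    rw [hGx, map_add, map_add, ← e₃]
    conv_lhs => rw [e₂]
    abel
  have h₂ : TensorProduct.map G G ∘ₗ comul = TensorProduct.map G (lengthProj k Q 0) ∘ₗ comul +
      stepOp h θ (TensorProduct.map G G ∘ₗ comul) := by
    ext x
    have e : TensorProduct.map G (stepOp (pathMul k Q) θ G) (comul x) =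
        stepOp h θ (TensorProduct.map G G ∘ₗ comul) x := by
      have e₁ : stepOp (pathMul k Q) θ G = pathMul k Q ∘ₗ (TensorProduct.map G θ ∘ₗ comul) := rfl
      have e₂ := map_map_comul G G θ x
      calc TensorProduct.map G (stepOp (pathMul k Q) θ G) (comul x)
          = (pathMul k Q).lTensor _
              (TensorProduct.map G (TensorProduct.map G θ ∘ₗ comul) (comul x)) := by
            rw [LinearMap.lTensor, TensorProduct.map_map, LinearMap.id_comp, e₁]
        _ = _ := by rw [e₂]; rfl
    rw [LinearMap.add_apply, ← e, LinearMap.comp_apply, LinearMap.comp_apply,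
      ← LinearMap.add_apply, ← TensorProduct.map_add_right, ← hG]
  have h₃ := eq_zero_of_eq_stepOp (h := h) hθ₀ (topSubcoalgebra k (PathCoalgebra k Q))
    (K := TensorProduct.map G G ∘ₗ comul - comul ∘ₗ G) (fun x _ => by
      rw [stepOp_sub]
      conv_lhs => rw [h₁, h₂]
      simp only [LinearMap.sub_apply, LinearMap.add_apply]
      abel) x trivial
  exact sub_eq_zero.1 h₃

theorem counit_of_recursion (hθ₁ : ∀ x, lengthProj k Q 1 (θ x) = θ x)
    (hG : G = lengthProj k Q 0 + stepOp (pathMul k Q) θ G) (x : PathCoalgebra k Q) :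
    counit (R := k) (G x) = counit x := by
  have e : counit ∘ₗ pathMul k Q ∘ₗ (lengthProj k Q 1).lTensor _ =
      (0 : PathCoalgebra k Q ⊗[k] PathCoalgebra k Q →ₗ[k] k) := by
    refine tensor_hom_ext_path fun a b c d p q => ?_
    by_cases hq : q.length = 1
    · by_cases hbc : b = c
      · subst hbc
        simp [lengthProj_ofPath, hq, pathMul_ofPath, counit_ofPath, Quiver.Path.length_comp]
      · simp [lengthProj_ofPath, hq, pathMul_ofPath_of_ne _ _ hbc]
    · simp [lengthProj_ofPath, hq]
  have e₁ : stepOp (pathMul k Q) θ G x = pathMul k Q ((lengthProj k Q 1).lTensor _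
      (TensorProduct.map G θ (comul x))) := by
    rw [LinearMap.lTensor, TensorProduct.map_map, LinearMap.id_comp,
      show lengthProj k Q 1 ∘ₗ θ = θ from LinearMap.ext hθ₁]
    rfl
  have e₂ := LinearMap.congr_fun e (TensorProduct.map G θ (comul x))
  simp only [LinearMap.comp_apply, LinearMap.zero_apply] at e₂
  have hGx : G x = lengthProj k Q 0 x + stepOp (pathMul k Q) θ G x := LinearMap.congr_fun hG x
  rw [hGx, map_add, counit_lengthProj_zero, e₁, e₂, add_zero]

theorem pathMul_mem_lengthLT {n : ℕ} {x y : PathCoalgebra k Q} (hx : x ∈ lengthLT k Q n)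
    (hy : lengthProj k Q 1 y = y) : pathMul k Q (x ⊗ₜ[k] y) ∈ lengthLT k Q (n + 1) := by
  have h : lengthLT k Q n ≤ (lengthLT k Q (n + 1)).comap (pathMul k Q ∘ₗ
      (TensorProduct.mk k _ _).flip y) := by
    refine Submodule.span_le.2 ?_
    rintro _ ⟨a, b, p, hp, rfl⟩
    change pathMul k Q (ofPath k p ⊗ₜ[k] y) ∈ lengthLT k Q (n + 1)
    rw [← hy]
    clear hy
    induction y using path_induction with
    | zero => simp
    | add y z hy hz =>
      simpa only [map_add, TensorProduct.tmul_add] using Submodule.add_mem _ hy hz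
    | @smul e c d q =>
      simp only [map_smul, TensorProduct.tmul_smul, lengthProj_ofPath]
      refine Submodule.smul_mem _ _ ?_
      split_ifs with hq
      · by_cases hbc : b = c
        · subst hbc
          rw [pathMul_ofPath]
          exact ofPath_mem_lengthLT (by rw [Quiver.Path.length_comp]; omega)
        · rw [pathMul_ofPath_of_ne _ _ hbc]
          exact Submodule.zero_mem _
      · simp
  exact h hx

/-- A solution of the recursion is unitriangular for the length filtration, hence bijective. -/
theorem bijective_of_recursion
    (hθ₀ : ∀ a : Q, θ (ofPath k (Quiver.Path.nil : Quiver.Path a a)) = 0)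
    (hθ₁ : ∀ x, lengthProj k Q 1 (θ x) = θ x)
    (hθ₂ : ∀ (a b : Q) (p : Quiver.Path a b), p.length = 1 → θ (ofPath k p) = ofPath k p)
    (hG : G = lengthProj k Q 0 + stepOp (pathMul k Q) θ G) : Function.Bijective G := by
  have key : ∀ n {a b : Q} (p : Quiver.Path a b), p.length = n →
      G (ofPath k p) - ofPath k p ∈ lengthLT k Q n := by
    intro n
    induction n using Nat.strong_induction_on with
    | _ n ih =>
      intro a b p hp
      have e : G (ofPath k p) - ofPath k p = (pathMul k Q ∘ₗ (TensorProduct.map G θ -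
          TensorProduct.map LinearMap.id (lengthProj k Q 1))) (comul (ofPath k p)) := by
        have h₁ : G (ofPath k p) = lengthProj k Q 0 (ofPath k p) +
          pathMul k Q (TensorProduct.map G θ (comul (ofPath k p))) :=
            LinearMap.congr_fun hG (ofPath k p)
        have h₂ := eq_lengthProj_zero_add (ofPath k p)
        rw [LinearMap.comp_apply, LinearMap.sub_apply, map_sub, h₁, sub_eq_sub_iff_add_eq_add,
          add_right_comm, ← h₂, add_comm]
      rw [e]
      refine map_comul_ofPath_mem _ _ p fun c q r hqr => ?_
      rw [LinearMap.comp_apply, LinearMap.sub_apply, TensorProduct.map_tmul,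
        TensorProduct.map_tmul, LinearMap.id_apply]
      match r, hqr with
      | .nil, _ => simp [hθ₀, lengthProj_ofPath]
      | .cons .nil α, hqr =>
        simp only [Quiver.Path.length_cons, Quiver.Path.length_nil] at hqr
        rw [hθ₂ _ _ _ (by simp), lengthProj_ofPath, if_pos (by simp), ← TensorProduct.sub_tmul]
        have h := pathMul_mem_lengthLT (ih q.length (by omega) q rfl)
          (y := ofPath k (Quiver.Path.nil.cons α)) (by simp [lengthProj_ofPath])
        rwa [show q.length + 1 = n by omega] at h
      | .cons (.cons r β) α, hqr =>
        simp only [Quiver.Path.length_cons] at hqr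
        rw [lengthProj_ofPath, if_neg (by simp), TensorProduct.tmul_zero, sub_zero]
        have h₁ : G (ofPath k q) ∈ lengthLT k Q (q.length + 1) := by
          rw [← sub_add_cancel (G (ofPath k q)) (ofPath k q)]
          exact Submodule.add_mem _ (lengthLT_mono (Nat.le_succ _) (ih q.length (by omega) q rfl))
            (ofPath_mem_lengthLT (Nat.lt_succ_self _))
        exact lengthLT_mono (by omega) (pathMul_mem_lengthLT h₁ (hθ₁ _))
  have h := bijective_id_add_of_lowering (N := G - LinearMap.id) fun a b p => key _ p rfl
  rwa [add_sub_cancel] at h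

end Universal

/-! ### Extension of coalgebra maps to automorphisms of the path coalgebra -/

section Extension

variable {k : Type w} [Field k] {Q : Type u} [Quiver.{v} Q]

theorem lengthProj_one_pathMul (z : PathCoalgebra k Q ⊗[k] PathCoalgebra k Q) :
    lengthProj k Q 1 (pathMul k Q (TensorProduct.map (lengthProj k Q 1) (lengthProj k Q 0) z)) =
      pathMul k Q (TensorProduct.map (lengthProj k Q 1) (lengthProj k Q 0) z) := by
  suffices h : lengthProj k Q 1 ∘ₗ pathMul k Q ∘ₗ
      TensorProduct.map (lengthProj k Q 1) (lengthProj k Q 0) =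
      pathMul k Q ∘ₗ TensorProduct.map (lengthProj k Q 1) (lengthProj k Q 0) from
    LinearMap.congr_fun h z
  refine tensor_hom_ext_path fun a b c d p q => ?_
  by_cases hp : p.length = 1 <;> by_cases hq : q.length = 0 <;> by_cases hbc : b = c
  · subst hbc
    simp [lengthProj_ofPath, hp, hq, pathMul_ofPath, Quiver.Path.length_comp]
  all_goals simp [lengthProj_ofPath, hp, hq, pathMul_ofPath_of_ne, hbc]

theorem pathMul_lengthProj_one_comul (x : PathCoalgebra k Q) :
    pathMul k Q (TensorProduct.map (lengthProj k Q 1) (lengthProj k Q 0) (comul x)) =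
      lengthProj k Q 1 x := by
  suffices h : pathMul k Q ∘ₗ TensorProduct.map (lengthProj k Q 1) (lengthProj k Q 0) ∘ₗ comul =
      lengthProj k Q 1 from LinearMap.congr_fun h x
  refine hom_ext_path fun a b p => ?_
  have e : TensorProduct.map (lengthProj k Q 1) (lengthProj k Q 0) =
      (lengthProj k Q 1).rTensor _ ∘ₗ TensorProduct.map LinearMap.id (lengthProj k Q 0) := by
    ext; simp
  rw [LinearMap.comp_apply, LinearMap.comp_apply, e, LinearMap.comp_apply,
    map_lengthProj_zero_comul, LinearMap.rTensor_tmul, lengthProj_ofPath]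
  split_ifs
  · rw [pathMul_ofPath, Quiver.Path.comp_nil]
  · simp

/-- The extension theorem for a coalgebra map that also respects the projection onto the span of
the vertices. -/
theorem exists_extension_of_lengthProj_zero {D M : Subcoalgebra k (PathCoalgebra k Q)}
    (hD : IsLarge D) (hDM : D.toSubmodule ≤ M.toSubmodule)
    {t : PathCoalgebra k Q →ₗ[k] PathCoalgebra k Q}
    (ht : ∀ x ∈ M.toSubmodule, comul (t x) = TensorProduct.map t t (comul x))
    (htD : ∀ x ∈ D.toSubmodule, t x = x)
    (ht₀ : ∀ x ∈ M.toSubmodule, lengthProj k Q 0 (t x) = lengthProj k Q 0 x) :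
    ∃ σ : PathCoalgebra k Q ≃ₗc[k] PathCoalgebra k Q, ∀ x ∈ M.toSubmodule, σ x = t x := by
  -- `θ` extends the arrow part `π₁ ∘ t` from `M` to `C`, compatibly with right end points
  let θ : PathCoalgebra k Q →ₗ[k] PathCoalgebra k Q :=
    pathMul k Q ∘ₗ TensorProduct.map (lengthProj k Q 1 ∘ₗ t) (lengthProj k Q 0) ∘ₗ comul
  have hθ₀ : ∀ a : Q, θ (ofPath k (Quiver.Path.nil : Quiver.Path a a)) = 0 := by
    intro a
    have := htD _ (hD a a .nil (Nat.zero_le _))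
    simp [θ, comul_ofPath, splits, this, lengthProj_ofPath]
  have hθ₁ : ∀ x, lengthProj k Q 1 (θ x) = θ x := by
    intro x
    have e : θ x = pathMul k Q (TensorProduct.map (lengthProj k Q 1) (lengthProj k Q 0)
        (t.rTensor _ (comul x))) := by
      rw [LinearMap.rTensor, TensorProduct.map_map, LinearMap.comp_id]
      rfl
    rw [e, lengthProj_one_pathMul]
  have hθM : ∀ x ∈ M.toSubmodule, θ x = lengthProj k Q 1 (t x) := by
    intro x hx
    rw [← pathMul_lengthProj_one_comul, ht x hx, TensorProduct.map_map]
    exact congrArg (pathMul k Q) (map_comul_congr M (fun _ _ => rfl)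
      (fun y hy => (ht₀ y hy).symm) hx)
  have hθ₂ : ∀ (a b : Q) (p : Quiver.Path a b), p.length = 1 → θ (ofPath k p) = ofPath k p := by
    intro a b p hp
    have hpD := hD a b p hp.le
    rw [hθM _ (hDM hpD), htD _ hpD, lengthProj_ofPath, if_pos hp]
  have hθ : ∀ x, TensorProduct.map LinearMap.id (lengthProj k Q 0) (comul (θ x)) =
      TensorProduct.map θ (lengthProj k Q 0) (comul x) := by
    intro x
    have e : (TensorProduct.map LinearMap.id (lengthProj k Q 0) ∘ₗ comul) ∘ₗ lengthProj k Q 0 =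
        TensorProduct.map (lengthProj k Q 0) (lengthProj k Q 0) ∘ₗ comul := by
      ext y
      simp only [LinearMap.comp_apply]
      rw [comul_lengthProj_zero, TensorProduct.map_map]
      congr 2
      exact LinearMap.ext lengthProj_zero_lengthProj_zero
    change TensorProduct.map LinearMap.id (lengthProj k Q 0) (comul (pathMul k Q
      (TensorProduct.map (lengthProj k Q 1 ∘ₗ t) (lengthProj k Q 0) (comul x)))) = _
    rw [map_lengthProj_zero_comul_pathMul, TensorProduct.map_map, LinearMap.id_comp, e,
      map_map_comul, LinearEquiv.symm_apply_apply, LinearMap.rTensor, TensorProduct.map_map]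
    rfl
  obtain ⟨G, hG⟩ := exists_eq_add_stepOp (h := pathMul k Q) hθ₀ (lengthProj k Q 0)
  have hGM : ∀ x ∈ M.toSubmodule, G x = t x := by
    intro x hx
    refine sub_eq_zero.1 (eq_zero_of_eq_stepOp (h := pathMul k Q) hθ₀ M (K := G - t) ?_ x hx)
    intro x hx
    have h₁ : t x = lengthProj k Q 0 x + stepOp (pathMul k Q) θ t x := by
      conv_lhs => rw [eq_lengthProj_zero_add (t x), ht₀ x hx, ht x hx, TensorProduct.map_map]
      exact congrArg (fun z => lengthProj k Q 0 x + pathMul k Q z)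
        (map_comul_congr M (fun _ _ => rfl) (fun y hy => (hθM y hy).symm) hx)
    have h₂ : G x = lengthProj k Q 0 x + stepOp (pathMul k Q) θ G x := LinearMap.congr_fun hG x
    rw [stepOp_sub, LinearMap.sub_apply, LinearMap.sub_apply, sub_eq_sub_iff_add_eq_add]
    conv_lhs => rw [h₂]
    conv_rhs => rw [h₁]
    abel
  let F : PathCoalgebra k Q →ₗc[k] PathCoalgebra k Q :=
    { G with
      counit_comp := LinearMap.ext (counit_of_recursion hθ₁ hG)
      map_comp_comul := LinearMap.ext (map_comul_of_recursion hθ₀ hθ₁ hθ hG) }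
  exact ⟨CoalgEquiv.ofBijective (f := F) (bijective_of_recursion hθ₀ hθ₁ hθ₂ hG), hGM⟩

theorem counit_smul_source {a b : Q} (p : Quiver.Path a b) :
    counit (R := k) (ofPath k p) • ofPath k (Quiver.Path.nil : Quiver.Path a a) =
      lengthProj k Q 0 (ofPath k p) := by
  cases p <;> simp [counit_ofPath, lengthProj_ofPath]

theorem counit_smul_target {a b : Q} (p : Quiver.Path a b) :
    counit (R := k) (ofPath k p) • ofPath k (Quiver.Path.nil : Quiver.Path b b) =
      lengthProj k Q 0 (ofPath k p) := by
  cases p <;> simp [counit_ofPath, lengthProj_ofPath]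

/-- `∑ π₀(x₁) ε(x₂ y) = π₀(x y)` -/
theorem lengthProj_zero_pathMul_left (z : PathCoalgebra k Q ⊗[k] PathCoalgebra k Q) :
    TensorProduct.rid k _ (TensorProduct.map (lengthProj k Q 0) (counit ∘ₗ pathMul k Q)
      (TensorProduct.assoc k _ _ _ (TensorProduct.map comul LinearMap.id z))) =
      lengthProj k Q 0 (pathMul k Q z) := by
  suffices h : (TensorProduct.rid k _).toLinearMap ∘ₗ
      TensorProduct.map (lengthProj k Q 0) (counit ∘ₗ pathMul k Q) ∘ₗ
      (TensorProduct.assoc k _ _ _).toLinearMap ∘ₗ TensorProduct.map comul LinearMap.id =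
      lengthProj k Q 0 ∘ₗ pathMul k Q from LinearMap.congr_fun h z
  refine tensor_hom_ext_path fun a b c d p q => ?_
  have h := sum_splits_left (k := k) p (fun r =>
    counit (R := k) (pathMul k Q (ofPath k r ⊗ₜ[k] ofPath k q)) •
      ofPath k (Quiver.Path.nil : Quiver.Path a a))
  have hl : ∀ {c : Q} (q : Quiver.Path a c), lengthProj k Q 0 (ofPath k q) =
      (if q.length = 0 then (1 : k) else 0) •
        ofPath k (Quiver.Path.nil : Quiver.Path a a) := by
    intro c q
    rw [← counit_smul_source, counit_ofPath]
  have h' : counit (R := k) (pathMul k Q (ofPath k p ⊗ₜ[k] ofPath k q)) •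
      ofPath k (Quiver.Path.nil : Quiver.Path a a) =
      lengthProj k Q 0 (pathMul k Q (ofPath k p ⊗ₜ[k] ofPath k q)) := by
    by_cases hbc : b = c
    · subst hbc
      rw [pathMul_ofPath, counit_smul_source]
    · simp [pathMul_ofPath_of_ne _ _ hbc]
  rw [LinearMap.comp_apply (lengthProj k Q 0), ← h', ← h]
  simp only [LinearMap.comp_apply, TensorProduct.map_tmul, comul_ofPath, list_sum_tmul,
    map_list_sum, List.map_map, Function.comp_def, LinearEquiv.coe_coe, LinearMap.id_apply,
    TensorProduct.assoc_tmul, TensorProduct.rid_tmul, hl]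
  exact congrArg List.sum (List.map_congr_left fun s _ => smul_comm _ _ _)

/-- `∑ ε(x y₁) π₀(y₂) = π₀(x y)` -/
theorem lengthProj_zero_pathMul_right (z : PathCoalgebra k Q ⊗[k] PathCoalgebra k Q) :
    TensorProduct.lid k _ (TensorProduct.map (counit ∘ₗ pathMul k Q) (lengthProj k Q 0)
      ((TensorProduct.assoc k _ _ _).symm (TensorProduct.map LinearMap.id comul z))) =
      lengthProj k Q 0 (pathMul k Q z) := by
  suffices h : (TensorProduct.lid k _).toLinearMap ∘ₗ
      TensorProduct.map (counit ∘ₗ pathMul k Q) (lengthProj k Q 0) ∘ₗ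
      (TensorProduct.assoc k _ _ _).symm.toLinearMap ∘ₗ TensorProduct.map LinearMap.id comul =
      lengthProj k Q 0 ∘ₗ pathMul k Q from LinearMap.congr_fun h z
  refine tensor_hom_ext_path fun a b c d p q => ?_
  have h := sum_splits_right (k := k) q (fun r =>
    counit (R := k) (pathMul k Q (ofPath k p ⊗ₜ[k] ofPath k r)) •
      ofPath k (Quiver.Path.nil : Quiver.Path d d))
  have hl : ∀ {c : Q} (q : Quiver.Path c d), lengthProj k Q 0 (ofPath k q) =
      (if q.length = 0 then (1 : k) else 0) •
        ofPath k (Quiver.Path.nil : Quiver.Path d d) := by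
    intro c q
    rw [← counit_smul_target, counit_ofPath]
  have h' : counit (R := k) (pathMul k Q (ofPath k p ⊗ₜ[k] ofPath k q)) •
      ofPath k (Quiver.Path.nil : Quiver.Path d d) =
      lengthProj k Q 0 (pathMul k Q (ofPath k p ⊗ₜ[k] ofPath k q)) := by
    by_cases hbc : b = c
    · subst hbc
      rw [pathMul_ofPath, counit_smul_target]
    · simp [pathMul_ofPath_of_ne _ _ hbc]
  rw [LinearMap.comp_apply (lengthProj k Q 0), ← h', ← h]
  simp only [LinearMap.comp_apply, TensorProduct.map_tmul, comul_ofPath, tmul_list_sum,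
    map_list_sum, List.map_map, Function.comp_def, LinearEquiv.coe_coe, LinearMap.id_apply,
    TensorProduct.assoc_symm_tmul, TensorProduct.lid_tmul, hl]
  exact congrArg List.sum (List.map_congr_left fun s _ => smul_comm _ _ _)

theorem counit_pathMul_comul (x : PathCoalgebra k Q) :
    counit (R := k) (pathMul k Q (comul x)) = counit x := by
  suffices h : counit ∘ₗ pathMul k Q ∘ₗ comul = (counit : PathCoalgebra k Q →ₗ[k] k) from
    LinearMap.congr_fun h x
  refine hom_ext_path fun a b p => ?_
  cases p with
  | nil => simp [comul_ofPath, splits, pathMul_ofPath]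
  | cons p α =>
    simp [comul_ofPath, splits, pathMul_ofPath, map_list_sum, Function.comp_def, counit_ofPath]

/-- A coalgebra map from a subcoalgebra `M` to the path coalgebra that is the identity on a large
subcoalgebra extends to an automorphism of the path coalgebra. -/
theorem exists_extension {D M : Subcoalgebra k (PathCoalgebra k Q)}
    (hD : IsLarge D) (hDM : D.toSubmodule ≤ M.toSubmodule)
    {t : PathCoalgebra k Q →ₗ[k] PathCoalgebra k Q}
    (ht : ∀ x ∈ M.toSubmodule, comul (t x) = TensorProduct.map t t (comul x))
    (htD : ∀ x ∈ D.toSubmodule, t x = x) :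
    ∃ σ : PathCoalgebra k Q ≃ₗc[k] PathCoalgebra k Q, ∀ x ∈ M.toSubmodule, σ x = t x := by
  -- `φ(x) = ∑ₐ eₐ(t(x₁)) eₐ(x₂)` conjugates the idempotents `eₐ` into the `eₐ ∘ t`
  let φ : PathCoalgebra k Q →ₗ[k] k :=
    (counit ∘ₗ pathMul k Q) ∘ₗ (TensorProduct.map t LinearMap.id ∘ₗ comul)
  have hφD : ∀ x ∈ D.toSubmodule, φ x = counit x := by
    intro x hx
    have e := map_comul_congr D (f := t) (f' := LinearMap.id) (g := LinearMap.id)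
      (g' := LinearMap.id) htD (fun _ _ => rfl) hx
    rw [TensorProduct.map_id, LinearMap.id_apply] at e
    rw [← counit_pathMul_comul]
    exact congrArg (fun z => counit (R := k) (pathMul k Q z)) e
  obtain ⟨ψ, h₁, h₂⟩ := exists_convolution_inverse (φ := φ) fun a => by
    rw [hφD _ (hD a a .nil (Nat.zero_le _)), counit_ofPath]
    simp
  have hl : ∀ y, lengthProj k Q 0 (leftHit φ y) =
      lengthProj k Q 0 (pathMul k Q (TensorProduct.map t LinearMap.id (comul y))) := by
    intro y
    have e : lengthProj k Q 0 ∘ₗ (TensorProduct.lid k _).toLinearMap ∘ₗ φ.rTensor _ =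
        (TensorProduct.lid k _).toLinearMap ∘ₗ TensorProduct.map (counit ∘ₗ pathMul k Q)
          (lengthProj k Q 0) ∘ₗ TensorProduct.map (TensorProduct.map t LinearMap.id ∘ₗ comul)
            LinearMap.id := by
      ext; simp [φ]
    have e' := LinearMap.congr_fun e (comul y)
    have e₂ := map_map_comul t LinearMap.id LinearMap.id y
    rw [TensorProduct.map_id, LinearMap.id_comp] at e₂
    simp only [LinearMap.comp_apply, LinearEquiv.coe_coe] at e'
    rw [← lengthProj_zero_pathMul_right, TensorProduct.map_map, LinearMap.comp_id,
      LinearMap.id_comp, e₂, LinearEquiv.symm_apply_apply]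
    exact e'
  have hr : ∀ y ∈ M.toSubmodule, lengthProj k Q 0 (t (rightHit φ y)) =
      lengthProj k Q 0 (pathMul k Q (TensorProduct.map t LinearMap.id (comul y))) := by
    intro y hy
    have e : lengthProj k Q 0 ∘ₗ t ∘ₗ (TensorProduct.rid k _).toLinearMap ∘ₗ φ.lTensor _ =
        (TensorProduct.rid k _).toLinearMap ∘ₗ TensorProduct.map (lengthProj k Q 0)
          (counit ∘ₗ pathMul k Q) ∘ₗ TensorProduct.map t
            (TensorProduct.map t LinearMap.id ∘ₗ comul) := by
      ext; simp [φ]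
    have e' := LinearMap.congr_fun e (comul y)
    simp only [LinearMap.comp_apply, LinearEquiv.coe_coe] at e'
    rw [map_map_comul] at e'
    have e₂ := map_comul_congr M (f := TensorProduct.map t t ∘ₗ comul) (f' := comul ∘ₗ t)
      (g := LinearMap.id) (g' := LinearMap.id) (fun x hx => (ht x hx).symm) (fun _ _ => rfl) hy
    rw [e₂] at e'
    rw [← lengthProj_zero_pathMul_left, TensorProduct.map_map, LinearMap.comp_id]
    exact e'
  let κ := innerAut φ ψ h₁ h₂
  have hκ : ∀ x ∈ M.toSubmodule, κ x ∈ M.toSubmodule := fun x hx => innerAut_mem M h₁ h₂ hx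
  have hκ' : ∀ x ∈ M.toSubmodule, κ.symm x ∈ M.toSubmodule := fun x hx => innerAut_mem M h₂ h₁ hx
  obtain ⟨σ, hσ⟩ : ∃ σ : PathCoalgebra k Q ≃ₗc[k] PathCoalgebra k Q,
      ∀ x ∈ M.toSubmodule, σ x = (t ∘ₗ κ.toCoalgHom.toLinearMap) x := by
    refine exists_extension_of_lengthProj_zero hD hDM (fun x hx => ?_) (fun x hx => ?_)
      (fun x hx => ?_)
    · have e := LinearMap.congr_fun κ.toCoalgHom.map_comp_comul x
      simp only [LinearMap.comp_apply] at e
      rw [TensorProduct.map_comp, LinearMap.comp_apply (TensorProduct.map t t), e]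
      exact ht _ (hκ x hx)
    · exact (congrArg t (innerAut_eq_self D h₁ h₂ hφD hx)).trans (htD x hx)
    · change lengthProj k Q 0 (t (leftHit ψ (rightHit φ x))) = _
      rw [← rightHit_leftHit, hr _ (leftHit_mem M ψ hx), ← hl, ← LinearMap.comp_apply (leftHit φ),
        leftHit_comp_leftHit_eq_id h₂, LinearMap.id_apply]
  refine ⟨κ.symm.trans σ, fun x hx => (hσ _ (hκ' x hx)).trans ?_⟩
  exact congrArg t (κ.apply_symm_apply x)

end Extension

/-! ### The Galois correspondence -/

section Correspondence

variable {k : Type w} [Field k] {Q : Type u} [Quiver.{v} Q]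

theorem IsLarge.mono {D M : Subcoalgebra k (PathCoalgebra k Q)} (hD : IsLarge D)
    (h : D.toSubmodule ≤ M.toSubmodule) : IsLarge M :=
  fun a b p hp => h (hD a b p hp)

/-- A large subcoalgebra is recovered from its Galois group: inner automorphisms suffice to move
every element outside it. -/
theorem relInv_relGal (hQ : IsAcyclic Q) {M E : Subcoalgebra k (PathCoalgebra k Q)}
    (hM : IsLarge M) (hME : M.toSubmodule ≤ E.toSubmodule) :
    relInv (relGal E M.toSubmodule) = M.toSubmodule := by
  refine le_antisymm ?_ fun x hx => ⟨⟨x, hME hx⟩, fun σ hσ => hσ _ hx, rfl⟩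
  rintro _ ⟨x, hx, rfl⟩
  refine mem_of_hits_eq hQ hM fun f hf => ?_
  have hφ : ∀ y ∈ M.toSubmodule,
      (counit + f : PathCoalgebra k Q →ₗ[k] k) y = counit y := fun y hy => by
    rw [LinearMap.add_apply, hf y hy, add_zero]
  obtain ⟨ψ, h₁, h₂⟩ := exists_convolution_inverse (φ := counit + f) fun a => by
    rw [hφ _ (hM a a .nil (Nat.zero_le _)), counit_ofPath]
    simp
  have hfix := hx (restrictAut E (innerAut _ ψ h₁ h₂) (map_innerAut E h₁ h₂))
    fun d hd => Subtype.ext (innerAut_eq_self M h₁ h₂ hφ hd)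
  have hfix' : leftHit ψ (rightHit (counit + f) (x : PathCoalgebra k Q)) = x :=
    congrArg Subtype.val hfix
  have h₃ := congrArg (leftHit (counit + f)) hfix'
  rw [← LinearMap.comp_apply, leftHit_comp_leftHit_eq_id h₂, LinearMap.id_apply, rightHit_add,
    leftHit_add, rightHit_counit, leftHit_counit, LinearMap.add_apply, LinearMap.add_apply] at h₃
  exact add_left_cancel h₃

/-- Every automorphism of `M` over a large subcoalgebra `D` extends to the path coalgebra. -/
theorem exists_galoisGroup_extending {D M : Subcoalgebra k (PathCoalgebra k Q)} (hD : IsLarge D)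
    (hDM : D.toSubmodule ≤ M.toSubmodule) {τ : M ≃ₗc[k] M} (hτ : τ ∈ relGal M D.toSubmodule) :
    ∃ σ ∈ galoisGroup D.toSubmodule, ∀ x : M, σ x = τ x := by
  obtain ⟨t, ht⟩ := LinearMap.exists_extend
    (M.toSubmodule.subtype ∘ₗ (τ.toCoalgHom.toLinearMap : M.toSubmodule →ₗ[k] M.toSubmodule))
  have ht' : ∀ x : M, t x = τ x := fun x => LinearMap.congr_fun ht x
  have htD : ∀ x ∈ D.toSubmodule, t x = x := fun x hx =>
    (ht' ⟨x, hDM hx⟩).trans (congrArg Subtype.val (hτ ⟨x, hDM hx⟩ hx))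
  obtain ⟨σ, hσ⟩ := exists_extension hD hDM (fun x hx => map_comul_of_extends τ ht' hx) htD
  exact ⟨σ, fun d hd => (hσ d (hDM hd)).trans (htD d hd), fun x => (hσ x x.2).trans (ht' x)⟩

theorem restrictAut_mem_relGal {D M : Subcoalgebra k (PathCoalgebra k Q)}
    {σ : PathCoalgebra k Q ≃ₗc[k] PathCoalgebra k Q} (hσ : σ ∈ galoisGroup D.toSubmodule)
    (h : M.toSubmodule.map ((σ : PathCoalgebra k Q ≃ₗ[k] PathCoalgebra k Q) :
      PathCoalgebra k Q →ₗ[k] PathCoalgebra k Q) = M.toSubmodule) :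
    restrictAut M σ h ∈ relGal M D.toSubmodule :=
  fun _ hd => Subtype.ext (hσ _ hd)

theorem isGaloisExtension_of_forall_mem {D M : Subcoalgebra k (PathCoalgebra k Q)}
    (hDM : D.toSubmodule ≤ M.toSubmodule)
    (h : ∀ σ ∈ galoisGroup D.toSubmodule, ∀ x ∈ M.toSubmodule, σ x ∈ M.toSubmodule) :
    IsGaloisExtension D M := by
  refine ⟨hDM, fun σ hσ => le_antisymm ?_ fun x hx => ?_⟩
  · rintro _ ⟨x, hx, rfl⟩
    exact h σ hσ x hx
  · exact ⟨σ.symm x, h σ⁻¹ (inv_mem hσ) x hx, σ.apply_symm_apply x⟩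

theorem IsGaloisExtension.apply_mem {D M : Subcoalgebra k (PathCoalgebra k Q)}
    (h : IsGaloisExtension D M) {σ : PathCoalgebra k Q ≃ₗc[k] PathCoalgebra k Q}
    (hσ : σ ∈ galoisGroup D.toSubmodule) {x : PathCoalgebra k Q} (hx : x ∈ M.toSubmodule) :
    σ x ∈ M.toSubmodule := by
  have h' := h.2 σ hσ
  exact h' ▸ Submodule.mem_map_of_mem hx

theorem relGal_sup (E : Subcoalgebra k (PathCoalgebra k Q)) {M N : Subcoalgebra k
    (PathCoalgebra k Q)} (hM : M.toSubmodule ≤ E.toSubmodule) (hN : N.toSubmodule ≤ E.toSubmodule) :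
    relGal E (M.sup N).toSubmodule = relGal E M.toSubmodule ⊓ relGal E N.toSubmodule := by
  ext σ
  refine ⟨fun h => ⟨fun d hd => h d (Submodule.mem_sup_left hd),
    fun d hd => h d (Submodule.mem_sup_right hd)⟩, fun h => ?_⟩
  rintro ⟨d, hd⟩ hd'
  obtain ⟨y, hy, z, hz, rfl⟩ := Submodule.mem_sup.1 hd'
  have h₁ := h.1 ⟨y, hM hy⟩ hy
  have h₂ := h.2 ⟨z, hN hz⟩ hz
  have h₃ := map_add σ ⟨y, hM hy⟩ ⟨z, hN hz⟩
  rw [h₁, h₂] at h₃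
  exact h₃

theorem relInv_sup {E : Subcoalgebra k (PathCoalgebra k Q)} (H G : Subgroup (E ≃ₗc[k] E)) :
    relInv (H ⊔ G) = relInv H ⊓ relInv G := by
  refine le_antisymm ?_ ?_
  · rintro _ ⟨x, hx, rfl⟩
    exact ⟨⟨x, fun σ hσ => hx σ (Subgroup.mem_sup_left hσ), rfl⟩,
      ⟨x, fun σ hσ => hx σ (Subgroup.mem_sup_right hσ), rfl⟩⟩
  · rintro _ ⟨⟨x, hx, rfl⟩, ⟨y, hy, hxy⟩⟩
    obtain rfl : y = x := Subtype.ext hxy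
    -- the automorphisms fixing `y` form a subgroup
    have h : H ⊔ G ≤ galoisGroup (Submodule.span k {y}) := by
      have hfix : ∀ σ : E ≃ₗc[k] E, σ y = y → σ ∈ galoisGroup (Submodule.span k {y}) := by
        intro σ hσ d hd
        obtain ⟨c, rfl⟩ := Submodule.mem_span_singleton.1 hd
        rw [map_smul, hσ]
      exact sup_le (fun σ hσ => hfix σ (hx σ hσ)) (fun σ hσ => hfix σ (hy σ hσ))
    exact ⟨y, fun σ hσ => h hσ y (Submodule.mem_span_singleton_self y), rfl⟩

theorem normal_iff_isGaloisExtension (hQ : IsAcyclic Q) {D M E : Subcoalgebra k (PathCoalgebra k Q)}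
    (hD : IsLarge D) (hE : IsGaloisExtension D E) (hDM : D.toSubmodule ≤ M.toSubmodule)
    (hME : M.toSubmodule ≤ E.toSubmodule) :
    ((relGal E M.toSubmodule).subgroupOf (relGal E D.toSubmodule)).Normal ↔
      IsGaloisExtension D M := by
  constructor
  · intro hn
    refine isGaloisExtension_of_forall_mem hDM fun σ hσ x hx => ?_
    rw [← relInv_relGal hQ (hD.mono hDM) hME]
    refine ⟨⟨σ x, hE.apply_mem hσ (hME hx)⟩, fun τ hτ => ?_, rfl⟩
    let s : relGal E D.toSubmodule :=
      ⟨restrictAut E σ (hE.2 σ hσ), restrictAut_mem_relGal hσ _⟩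
    let τ' : relGal E D.toSubmodule := ⟨τ, fun d hd => hτ d (hDM hd)⟩
    have h₁ := hn.conj_mem τ' hτ s⁻¹
    rw [inv_inv, Subgroup.mem_subgroupOf] at h₁
    have h₂ : (s : E ≃ₗc[k] E).symm (τ ((s : E ≃ₗc[k] E) ⟨x, hME hx⟩)) = ⟨x, hME hx⟩ :=
      h₁ ⟨x, hME hx⟩ hx
    have h₃ := congrArg (s : E ≃ₗc[k] E) h₂
    rw [CoalgEquiv.apply_symm_apply] at h₃
    exact h₃
  · intro hM
    refine ⟨fun τ hτ s => ?_⟩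
    rw [Subgroup.mem_subgroupOf] at hτ ⊢
    intro d hd
    obtain ⟨σ, hσ, hσs⟩ := exists_galoisGroup_extending hD hE.1 (inv_mem s.2)
    have h₁ : ((((s : E ≃ₗc[k] E)⁻¹ : E ≃ₗc[k] E) d : E) : PathCoalgebra k Q) ∈ M.toSubmodule :=
      hσs d ▸ hM.apply_mem hσ hd
    have h₂ := hτ _ h₁
    change (s : E ≃ₗc[k] E) ((τ : E ≃ₗc[k] E) ((s : E ≃ₗc[k] E)⁻¹ d)) = d
    rw [h₂]
    exact (s : E ≃ₗc[k] E).apply_symm_apply d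

/-- Restriction to `M` identifies `Gal(E/D) / Gal(E/M)` with `Gal(M/D)`. -/
theorem nonempty_quotient_mulEquiv {D M E : Subcoalgebra k (PathCoalgebra k Q)}
    (hD : IsLarge D) (hE : IsGaloisExtension D E) (hM : IsGaloisExtension D M)
    (hME : M.toSubmodule ≤ E.toSubmodule)
    [((relGal E M.toSubmodule).subgroupOf (relGal E D.toSubmodule)).Normal] :
    Nonempty ((relGal E D.toSubmodule ⧸
      (relGal E M.toSubmodule).subgroupOf (relGal E D.toSubmodule)) ≃*
        relGal M D.toSubmodule) := by
  choose L hL hLτ using fun τ : relGal E D.toSubmodule =>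
    exists_galoisGroup_extending hD hE.1 τ.2
  let r : relGal E D.toSubmodule → relGal M D.toSubmodule := fun τ =>
    ⟨restrictAut M (L τ) (hM.2 _ (hL τ)), restrictAut_mem_relGal (hL τ) _⟩
  have hr : ∀ (τ : relGal E D.toSubmodule) (x : M),
      (((r τ : M ≃ₗc[k] M) x : M) : PathCoalgebra k Q) =
        ((τ : E ≃ₗc[k] E) ⟨x, hME x.2⟩ : E) := fun τ x => hLτ τ ⟨x, hME x.2⟩
  let f : relGal E D.toSubmodule →* relGal M D.toSubmodule :=
    MonoidHom.mk' r fun τ τ' => by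
      refine Subtype.ext (CoalgEquiv.ext fun x => Subtype.ext ?_)
      have h₁ := hr (τ * τ') x
      have h₂ : ((((r τ * r τ' : relGal M D.toSubmodule) : M ≃ₗc[k] M) x : M) :
          PathCoalgebra k Q) = _ := hr τ ((r τ' : M ≃ₗc[k] M) x)
      rw [h₁, h₂]
      have h₃ : (⟨((r τ' : M ≃ₗc[k] M) x : M), hME (((r τ' : M ≃ₗc[k] M) x : M)).2⟩ : E) =
        (τ' : E ≃ₗc[k] E) ⟨x, hME x.2⟩ := Subtype.ext (hr τ' x)
      rw [h₃]
      rfl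
  have hf : Function.Surjective f := by
    intro ρ
    obtain ⟨σ, hσ, hσρ⟩ := exists_galoisGroup_extending hD hM.1 ρ.2
    refine ⟨⟨restrictAut E σ (hE.2 σ hσ), restrictAut_mem_relGal hσ _⟩, ?_⟩
    exact Subtype.ext (CoalgEquiv.ext fun x => Subtype.ext ((hr _ x).trans (hσρ x)))
  have hker : f.ker = (relGal E M.toSubmodule).subgroupOf (relGal E D.toSubmodule) := by
    ext τ
    rw [MonoidHom.mem_ker, Subgroup.mem_subgroupOf]
    constructor
    · intro h d hd
      have h₁ : (r τ : M ≃ₗc[k] M) ⟨d, hd⟩ = ⟨d, hd⟩ :=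
        congrArg (fun ρ : relGal M D.toSubmodule => (ρ : M ≃ₗc[k] M) ⟨d, hd⟩) h
      exact Subtype.ext ((hr τ ⟨d, hd⟩).symm.trans (congrArg Subtype.val h₁))
    · intro h
      refine Subtype.ext (CoalgEquiv.ext fun x => Subtype.ext ((hr τ x).trans ?_))
      exact congrArg Subtype.val (h ⟨x, hME x.2⟩ x.2)
  exact ⟨(QuotientGroup.quotientMulEquivOfEq hker.symm).trans
    (QuotientGroup.quotientKerEquivOfSurjective f hf)⟩

end Correspondence

end PathGalois

end

open PathGalois in
theorem theorem4p8 {k : Type w} [Field k] {Q : Type u} [Quiver.{v} Q] (hQ : IsAcyclic Q)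
    (D E : Subcoalgebra k (PathCoalgebra k Q)) (hD : IsLarge D) (hE : IsGaloisExtension D E) :
    -- (1) `Inv` is well defined on `𝒢(D, E)`, and `Inv` and `Gal(E/-)` are mutually inverse
    ((∀ M ∈ intermediateCoalgebras D E, relGal E M.toSubmodule ∈ admissibleSubgroups D E) ∧
      (∀ H ∈ admissibleSubgroups D E, ∃ M ∈ intermediateCoalgebras D E, M.toSubmodule = relInv H) ∧
      (∀ M ∈ intermediateCoalgebras D E, relInv (relGal E M.toSubmodule) = M.toSubmodule) ∧
      (∀ H ∈ admissibleSubgroups D E, relGal E (relInv H) = H)) ∧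
    -- (2) generated subgroups correspond to intersections, and intersections to sums
    (∀ M ∈ intermediateCoalgebras D E, ∀ N ∈ intermediateCoalgebras D E,
      relInv (relGal E M.toSubmodule ⊔ relGal E N.toSubmodule) = M.toSubmodule ⊓ N.toSubmodule ∧
      relInv (relGal E M.toSubmodule ⊓ relGal E N.toSubmodule) = M.toSubmodule ⊔ N.toSubmodule) ∧
    -- (3) normal subgroups correspond to Galois extensions
    (∀ H ∈ admissibleSubgroups D E, H ≤ relGal E D.toSubmodule ∧
      ∃ M ∈ intermediateCoalgebras D E, M.toSubmodule = relInv H ∧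
        ((H.subgroupOf (relGal E D.toSubmodule)).Normal ↔ IsGaloisExtension D M) ∧
        ∀ [(H.subgroupOf (relGal E D.toSubmodule)).Normal],
          Nonempty ((relGal E D.toSubmodule ⧸ H.subgroupOf (relGal E D.toSubmodule)) ≃*
            relGal M D.toSubmodule)) := by
  have key : ∀ M ∈ intermediateCoalgebras D E,
      relInv (relGal E M.toSubmodule) = M.toSubmodule :=
    fun M hM => relInv_relGal hQ (hD.mono hM.1) hM.2
  refine ⟨⟨fun M hM => ⟨M, hM, rfl⟩, ?_, key, ?_⟩, fun M hM N hN => ⟨?_, ?_⟩, ?_⟩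
  · rintro _ ⟨M, hM, rfl⟩
    exact ⟨M, hM, (key M hM).symm⟩
  · rintro _ ⟨M, hM, rfl⟩
    rw [key M hM]
  · rw [relInv_sup, key M hM, key N hN]
  · rw [← relGal_sup E hM.2 hN.2]
    exact key (M.sup N) ⟨hM.1.trans le_sup_left, sup_le hM.2 hN.2⟩
  · rintro _ ⟨M, hM, rfl⟩
    have hn := normal_iff_isGaloisExtension hQ hD hE hM.1 hM.2
    refine ⟨fun σ hσ d hd => hσ d (hM.1 hd), M, hM, (key M hM).symm, hn, ?_⟩
    intro inst
    exact nonempty_quotient_mulEquiv hD hE (hn.1 inst) hM.2
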